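/- Setting. Let $X$ be a set and let $\mathfrak S\subset\mathfrak P(X)$ be an interval system: for all $A,B\in\mathfrak S$ both $A\setminus B$ and $A\cap B$ are countable disjoint unions of elements of $\mathfrak S$. Let $\boldsymbol\Sigma\mathfrak S$, $\boldsymbol\Sigma_0\mathfrak S$, $\boldsymbol\Sigma_{00}\mathfrak S$ be the families of countable unions, finite unions and finite disjoint unions of elements of $\mathfrak S$ (the empty union is allowed). For $A,B\in\boldsymbol\Sigma_{00}\mathfrak S$ write $A\,\dot\subset\,B$ if $B$ is the disjoint union of $A$ and some $C\in\boldsymbol\Sigma_{00}\mathfrak S$. Let $\mathcal V,\mathcal W,\mathcal Z$ be commutative topological groups, complete and Hausdorff (the topology of $\mathcal V$ plays no role). Let $\mu:\mathfrak S\to\mathcal W$ be a measure, that is, $\mu(A)=\sum_\lambda\mu(A_\lambda)$ with unconditional convergence for every countable disjoint decomposition $A=\bigcup_\lambda A_\lambda$ within $\mathfrak S$. Let $L:\mathcal V\times\mathcal W\to\mathcal Z$ be biadditive and continuous in its second variable. Let $f:X\to\mathcal V$ and $a\in\mathcal Z$. The integrals. For $\mathcal A\subset\mathcal V\times X$ and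 $D\subset X$ put $\mathcal A^D=\{v:(v,x)\in\mathcal A\text{ for all }x\in D\}$. An envelope is a set $\mathcal A\subset\mathcal V\times X$ that contains the graph of some step function $\sum_{j\in J}c_j\chi_{E_j}$ ($J$ finite, $c_j\in\mathcal V$, $E_j\in\mathfrak S$) and satisfies $$\mathcal A=\Bigl(\bigcup_{D\in\mathfrak D}\mathcal A^D\times D\Bigr)\cup\Bigl(\{0\}\times\bigl(X\setminus\textstyle\bigcup\mathfrak D\bigr)\Bigr)$$ for some countable $\mathfrak D\subset\mathfrak S$. It approximates a function if it contains its graph. Let $\int^{\mathrm p}L(\mathcal A,\mu)$ be the closure of the set of all sums $\sum_{j\in J}L(c_j,\mu(E_j))$ with $J$ finite, $c_j\in\mathcal V$, $E_j\in\mathfrak S$ and the graph of $\sum_{j\in J}c_j\chi_{E_j}$ contained in $\mathcal A$. The Lebesgue–McShane integral of $f$ is $a$ if for every neighborhood $\mathcal T$ of $0$ in $\mathcal Z$ there is an envelope $\mathcal A$ approximating $f$ with $\int^{\mathrm p}L(\mathcal A,\mu)\subset a+\mathcal T$. For $B\subset X$ let $f|_B$ be the function equal to $f$ on $B$ and to $0$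 outside $B$. The extended Lebesgue–McShane integral of $f$ is $a$ if for every neighborhood $\mathcal T$ of $0$ in $\mathcal Z$ and every $A_0\in\boldsymbol\Sigma_{00}\mathfrak S$ there is $A'\in\boldsymbol\Sigma_{00}\mathfrak S$ disjoint from $A_0$ such that for every $B\in\boldsymbol\Sigma\mathfrak S$ with $A_0\cup A'\subset B$ there is an envelope $\mathcal B$ approximating $f|_B$ with $\int^{\mathrm p}L(\mathcal B,\mu)\subset a+\mathcal T$. The filters. A tag system $(\mathfrak D,h)$ supported on $A$ consists of a countable $\mathfrak D\subset\mathfrak S$ with $\bigcup\mathfrak D=A$ and a map $h:A\to\mathfrak D$ with $x\in h(x)$ for all $x\in A$. A tagged division associated to it is a pair $(\mathfrak E,c)$, where $\mathfrak E$ is a countable set of pairwise disjoint nonempty elements of $\mathfrak S$ with $\bigcup\mathfrak E=A$, and $c:\mathfrak E\to A$ satisfies $E\subset h(c(E))$ for all $E\in\mathfrak E$. Let $\mathsf F(X,\mathfrak S)$ be the free abelian group on the symbols $\delta_x\cdot E$ ($x\in X$, $E\in\mathfrak S$), and let $$L(f,\mu):\mathsf F(X,\mathfrak S)\to\mathcal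 Z,\qquad \sum_j\delta_{x_j}\cdot E_j\mapsto\sum_jL(f(x_j),\mu(E_j)).$$ Define the following filters on $\mathsf F(X,\mathfrak S)$. - $\mathfrak F_{(\mathfrak E,c)}$ is generated by the sets $\bigl\{\sum_{E\in\Omega}\delta_{c(E)}\cdot E:\Xi\subset\Omega\subset\mathfrak E,\ \Omega\text{ finite}\bigr\}$, for $\Xi\subset\mathfrak E$ finite. - ${}^{\mathrm{LM}}\mathfrak F^{(\mathfrak D,h)}$ is the finest common coarsening of the $\mathfrak F_{(\mathfrak E,c)}$ over all tagged divisions associated to $(\mathfrak D,h)$. - For $A\in\boldsymbol\Sigma\mathfrak S$, ${}^{\mathrm{LM}}\mathfrak F^{A}$ is the coarsest common refinement of the ${}^{\mathrm{LM}}\mathfrak F^{(\mathfrak D,h)}$ over all tag systems supported on $A$. - For a preordered set $(P,\le)$ and filters $\mathfrak F_p$ ($p\in P$), let $\lim^{\le}_{p\in P}\mathfrak F_p$ be the coarsest common refinement, over all upward closed cofinal $S\subset P$, of the finest common coarsening of the $\mathfrak F_p$, $p\in S$. The Lebesgue–McShane filters of countable, finite and disjoint finite kind are $${}^{\mathrm{LM}}\mathfrak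 F^{\mathfrak S}=\lim_{A\in\boldsymbol\Sigma\mathfrak S}^{\subset}{}^{\mathrm{LM}}\mathfrak F^A,\qquad {}^{\mathrm{LM}}\mathfrak F_0^{\mathfrak S}=\lim_{A\in\boldsymbol\Sigma_0\mathfrak S}^{\subset}{}^{\mathrm{LM}}\mathfrak F^A,\qquad {}^{\mathrm{LM}}\mathfrak F_{00}^{\mathfrak S}=\lim_{A\in\boldsymbol\Sigma_{00}\mathfrak S}^{\dot\subset}{}^{\mathrm{LM}}\mathfrak F^A .$$ Statement. (1) The following are equivalent: - the extended Lebesgue–McShane integral of $f$ is $a$; - the image $L(f,\mu)_*\,{}^{\mathrm{LM}}\mathfrak F^{\mathfrak S}$ converges to $a$; - the image $L(f,\mu)_*\,{}^{\mathrm{LM}}\mathfrak F_0^{\mathfrak S}$ converges to $a$; - the image $L(f,\mu)_*\,{}^{\mathrm{LM}}\mathfrak F_{00}^{\mathfrak S}$ converges to $a$. (2) If $X\in\boldsymbol\Sigma\mathfrak S$, then the following are equivalent: - the Lebesgue–McShane integral of $f$ is $a$; - the extended Lebesgue–McShane integral of $f$ is $a$; - the image $L(f,\mu)_*\,{}^{\mathrm{LM}}\mathfrak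 F^{X}$ converges to $a$. -/

import Mathlib

open Filter Topology

noncomputable section

namespace LM

/-! ### Interval systems and measures -/

section SetSystems

variable {X : Type*}

/-- `IsDecomposition 𝔖 A 𝔇`: `𝔇` is a countable family of pairwise disjoint members of `𝔖`
whose union is `A`. -/
def IsDecomposition (𝔖 : Set (Set X)) (A : Set X) (𝔇 : Set (Set X)) : Prop :=
  𝔇 ⊆ 𝔖 ∧ 𝔇.Countable ∧ 𝔇.PairwiseDisjoint id ∧ ⋃₀ 𝔇 = A

/-- An interval system: differences and intersections of two members are countable disjoint
unions of members. -/
def IsIntervalSystem (𝔖 : Set (Set X)) : Prop :=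
  ∀ A ∈ 𝔖, ∀ B ∈ 𝔖,
    (∃ ℭ, IsDecomposition 𝔖 (A \ B) ℭ) ∧ (∃ 𝔇, IsDecomposition 𝔖 (A ∩ B) 𝔇)

/-- Countable unions of members of `𝔖`. -/
def sigmaSets (𝔖 : Set (Set X)) : Set (Set X) :=
  {A | ∃ 𝔇 ⊆ 𝔖, 𝔇.Countable ∧ ⋃₀ 𝔇 = A}

/-- Finite unions of members of `𝔖`. -/
def sigmaZeroSets (𝔖 : Set (Set X)) : Set (Set X) :=
  {A | ∃ 𝔇 ⊆ 𝔖, 𝔇.Finite ∧ ⋃₀ 𝔇 = A}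

/-- Finite disjoint unions of members of `𝔖`. -/
def sigmaZeroZeroSets (𝔖 : Set (Set X)) : Set (Set X) :=
  {A | ∃ 𝔇 ⊆ 𝔖, 𝔇.Finite ∧ 𝔇.PairwiseDisjoint id ∧ ⋃₀ 𝔇 = A}

/-- `B` is the disjoint union of `A` and a finite disjoint union of members of `𝔖`. -/
def DotSubset (𝔖 : Set (Set X)) (A B : Set X) : Prop :=
  ∃ C ∈ sigmaZeroZeroSets 𝔖, Disjoint A C ∧ A ∪ C = B

/-- `μ` is a `W`-valued measure on `𝔖`: it is additive, with unconditional convergence, along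
all countable (possibly finite or empty) disjoint decompositions inside `𝔖`. Only the values of
`μ` on members of `𝔖` matter. -/
def IsMeasureOn {W : Type*} [AddCommMonoid W] [TopologicalSpace W]
    (𝔖 : Set (Set X)) (μ : Set X → W) : Prop :=
  ∀ (Λ : Type) [Countable Λ] (A : Λ → Set X), (∀ i, A i ∈ 𝔖) →
    Pairwise (fun i j => Disjoint (A i) (A j)) → (⋃ i, A i) ∈ 𝔖 →
      HasSum (fun i => μ (A i)) (μ (⋃ i, A i))

end SetSystems

/-! ### Envelopes -/

section Envelopes

variable {X V : Type*} [AddCommGroup V]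

/-- The graph of `f`, as a subset of `V × X`. -/
def graph (f : X → V) : Set (V × X) := {p | p.1 = f p.2}

/-- The values `v` with `(v, x) ∈ 𝒜` for all `x ∈ R`. -/
def fibre (𝒜 : Set (V × X)) (R : Set X) : Set V := {v | ∀ x ∈ R, (v, x) ∈ 𝒜}

/-- The subset of `V × X` generated from `𝒜` by the set system `𝔇`. -/
def generated (𝔇 : Set (Set X)) (𝒜 : Set (V × X)) : Set (V × X) :=
  (⋃ D ∈ 𝔇, fibre 𝒜 D ×ˢ D) ∪ ({0} ×ˢ (⋃₀ 𝔇)ᶜ)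

/-- The function `∑ j, c j • χ_{E j}`. -/
def stepFun {n : ℕ} (c : Fin n → V) (E : Fin n → Set X) (x : X) : V :=
  ∑ j, (E j).indicator (fun _ => c j) x

/-- An envelope: a set containing the graph of a step function over `𝔖` and having a countable
generating system in `𝔖`. -/
def IsEnvelope (𝔖 : Set (Set X)) (𝒜 : Set (V × X)) : Prop :=
  (∃ (n : ℕ) (c : Fin n → V) (E : Fin n → Set X),
    (∀ j, E j ∈ 𝔖) ∧ graph (stepFun c E) ⊆ 𝒜) ∧
  ∃ 𝔇 ⊆ 𝔖, 𝔇.Countable ∧ 𝒜 = generated 𝔇 𝒜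

variable {W Z : Type*} [AddCommGroup W] [AddCommGroup Z] [TopologicalSpace Z]

/-- The bilinear sum of an envelope: the closure of the set of the sums `∑ j, L (c j) (μ (E j))`
over the step functions `∑ j, c j • χ_{E j}` whose graph lies in `𝒜`. -/
def preIntegral (L : V →+ W →+ Z) (𝔖 : Set (Set X)) (μ : Set X → W) (𝒜 : Set (V × X)) : Set Z :=
  closure {z | ∃ (n : ℕ) (c : Fin n → V) (E : Fin n → Set X),
    (∀ j, E j ∈ 𝔖) ∧ graph (stepFun c E) ⊆ 𝒜 ∧ z = ∑ j, L (c j) (μ (E j))}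

/-- `a` is the (ordinary) Lebesgue–McShane integral of `f`. -/
def IsIntegral (L : V →+ W →+ Z) (𝔖 : Set (Set X)) (μ : Set X → W) (f : X → V) (a : Z) : Prop :=
  ∀ T ∈ 𝓝 (0 : Z), ∃ 𝒜 : Set (V × X), IsEnvelope 𝔖 𝒜 ∧ graph f ⊆ 𝒜 ∧
    preIntegral L 𝔖 μ 𝒜 ⊆ (fun t => a + t) '' T

/-- `a` is the extended Lebesgue–McShane integral of `f`. Here `B.indicator f` is the function
which is `f` on `B` and `0` outside of `B`. -/
def IsExtIntegral (L : V →+ W →+ Z) (𝔖 : Set (Set X)) (μ : Set X → W) (f : X → V) (a : Z) : Prop :=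
  ∀ T ∈ 𝓝 (0 : Z), ∀ A₀ ∈ sigmaZeroZeroSets 𝔖, ∃ A' ∈ sigmaZeroZeroSets 𝔖, Disjoint A₀ A' ∧
    ∀ B ∈ sigmaSets 𝔖, A₀ ∪ A' ⊆ B →
      ∃ ℬ : Set (V × X), IsEnvelope 𝔖 ℬ ∧ graph (B.indicator f) ⊆ ℬ ∧
        preIntegral L 𝔖 μ ℬ ⊆ (fun t => a + t) '' T

end Envelopes

/-! ### Constructions on filters -/

/-- The filter of the formal sum of a family `v`: it is generated by the sets
`{∑ i ∈ Ω, v i | Ξ ⊆ Ω finite}`, where `Ξ` ranges over the finite sets of indices. -/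
def formalSumFilter {ι G : Type*} [AddCommMonoid G] (v : ι → G) : Filter G :=
  map (fun Ω : Finset ι => ∑ i ∈ Ω, v i) atTop

/-- `S` is a top for the preorder `r`: it is cofinal and upward closed. -/
def IsTopSet {P : Type*} (r : P → P → Prop) (S : Set P) : Prop :=
  (∀ p, ∃ s ∈ S, r p s) ∧ ∀ s ∈ S, ∀ t, r s t → t ∈ S

/-- The limit of the filters `F p` as `p` increases along the preorder `r`: the coarsest common
refinement (`⨅`), over all tops `S`, of the finest common coarsening (`⨆`) of the `F p`, `p ∈ S`. -/
def limitFilter {P β : Type*} (r : P → P → Prop) (F : P → Filter β) : Filter β :=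
  ⨅ (S : Set P) (_ : IsTopSet r S), ⨆ p ∈ S, F p

/-! ### Tag systems, tagged divisions and their filters -/

section Tags

variable {X : Type*} {𝔖 : Set (Set X)}

/-- A tag system: a countable family of members of `𝔖` and a function assigning to each point of
the union a member of the family containing that point. -/
structure TagSystem (𝔖 : Set (Set X)) where
  sets : Set (Set X)
  sets_subset : sets ⊆ 𝔖
  countable : sets.Countable
  h : ↥(⋃₀ sets) → Set X
  h_mem : ∀ x, h x ∈ sets
  mem_h : ∀ x, (x : X) ∈ h x

/-- The set on which a tag system is supported. -/
def TagSystem.support (D : TagSystem 𝔖) : Set X := ⋃₀ D.sets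

/-- A tagged Lebesgue–McShane division associated to a tag system: a countable decomposition of
the supporting set into nonempty members `E` of `𝔖`, each with a tag `c E` in the supporting set
(not necessarily in `E`) such that `E ⊆ h (c E)`. -/
structure TaggedDivision (D : TagSystem 𝔖) where
  sets : Set (Set X)
  isDecomposition : IsDecomposition 𝔖 D.support sets
  nonempty : ∀ E ∈ sets, E.Nonempty
  c : sets → ↥(⋃₀ D.sets)
  subset_h : ∀ E : sets, (E : Set X) ⊆ D.h (c E)

/-- The group of finite formal sums `∑ δ_{x_j} · E_j`. -/
abbrev FormalSums (𝔖 : Set (Set X)) : Type _ := FreeAbelianGroup (X × 𝔖)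

/-- The filter of a tagged division: that of the formal sum `∑ δ_{c E} · E`. -/
def TaggedDivision.filter {D : TagSystem 𝔖} (P : TaggedDivision D) : Filter (FormalSums 𝔖) :=
  formalSumFilter fun E : P.sets =>
    FreeAbelianGroup.of (((P.c E : X), ⟨(E : Set X), P.isDecomposition.1 E.2⟩) : X × 𝔖)

/-- The filter of a tag system: the finest common coarsening of those of its divisions. -/
def TagSystem.filter (D : TagSystem 𝔖) : Filter (FormalSums 𝔖) :=
  ⨆ P : TaggedDivision D, P.filter

/-- The Lebesgue–McShane filter of a set `A`: the coarsest common refinement of the filters of the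
tag systems supported on `A`. -/
def lmFilter (𝔖 : Set (Set X)) (A : Set X) : Filter (FormalSums 𝔖) :=
  ⨅ (D : TagSystem 𝔖) (_ : D.support = A), D.filter

/-- The Lebesgue–McShane filter of countable kind. -/
def lmFilterCountable (𝔖 : Set (Set X)) : Filter (FormalSums 𝔖) :=
  limitFilter (fun A B : sigmaSets 𝔖 => (A : Set X) ⊆ B) fun A => lmFilter 𝔖 A

/-- The Lebesgue–McShane filter of finite kind. -/
def lmFilterFinite (𝔖 : Set (Set X)) : Filter (FormalSums 𝔖) :=
  limitFilter (fun A B : sigmaZeroSets 𝔖 => (A : Set X) ⊆ B) fun A => lmFilter 𝔖 A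

/-- The Lebesgue–McShane filter of disjoint finite kind. -/
def lmFilterDisjointFinite (𝔖 : Set (Set X)) : Filter (FormalSums 𝔖) :=
  limitFilter (fun A B : sigmaZeroZeroSets 𝔖 => DotSubset 𝔖 A B) fun A => lmFilter 𝔖 A

/-- The action on formal sums: `∑ δ_{x_j} · E_j ↦ ∑ L (f x_j) (μ (E_j))`. -/
def evalFormal {V W Z : Type*} [AddCommGroup V] [AddCommGroup W] [AddCommGroup Z]
    (L : V →+ W →+ Z) (μ : Set X → W) (f : X → V) : FormalSums 𝔖 →+ Z :=
  FreeAbelianGroup.lift fun p : X × 𝔖 => L (f p.1) (μ p.2)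

end Tags

end LM

end

/-! Every condition is translated into one pivot, `Controls`: a gauge `r` on `A`, that is, a choice
for each point of one of countably many members of `𝔖` containing it, such that for every division
of `A` subordinate to `r` the finite Riemann sums eventually lie in `T`. Since gauges can be
intersected and tops can be intersected, the infima defining the filters are directed. Convergence
along them therefore becomes a statement "beyond some `A₁`, every `B` is controlled"
(`preimage_mem_lmFilter_iff`, `tendsto_limitFilter_iff`).

Envelopes and gauges determine each other up to a small enlargement of the neighborhood. An envelope
of `f|_B` yields a gauge: `r x` is a generating set over the whole of which the value `f x` is
allowed. A finite Riemann sum is then, up to the small tail of the envelope's own step function, the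
sum of a function inside the envelope (`exists_controls_of_envelope`). Conversely, the sets `{f x} ×
r x`, together with the value `0` outside finitely many cells of a division, form an envelope.
Allowing `0` there costs little, because Riemann sums inside all but finitely many cells are small
(`Controls.exists_finset_tail`, `Controls.exists_envelope`).

It remains to compare the families of supporting sets. Control on all large countable unions is the
strongest condition. Control on all large sets, countable or finite unions, passes to disjoint
finite unions because the part of the large set outside a big finite piece contributes little
(`exists_controls_disjoint_finite_of_union`). Control on disjoint finite unions passes back to
countable unions by gluing countably many gauges with errors that sum to a small total, Henstock's
lemma making the local errors small (`exists_controls_of_disjoint_finite`). -/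

namespace LM

/-! ### Countable partitions into members of an interval system. -/

section Partitions

variable {X : Type*} {𝔖 : Set (Set X)}

/-- A decomposition into nonempty members, in pointwise form. -/
structure IsPartition (𝔖 : Set (Set X)) (A : Set X) (𝔈 : Set (Set X)) : Prop where
  sub : 𝔈 ⊆ 𝔖
  countable : 𝔈.Countable
  nonempty : ∀ E ∈ 𝔈, E.Nonempty
  eq_of_mem : ∀ E ∈ 𝔈, ∀ F ∈ 𝔈, ∀ x, x ∈ E → x ∈ F → E = F
  mem_iff : ∀ x, x ∈ A ↔ ∃ E ∈ 𝔈, x ∈ E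

/-- `A` has a partition into members of `𝔖` satisfying `p`. -/
def HasPartition (𝔖 : Set (Set X)) (p : Set X → Prop) (A : Set X) : Prop :=
  ∃ 𝔈, IsPartition 𝔖 A 𝔈 ∧ ∀ E ∈ 𝔈, p E

/-- `A` has a partition into members of `𝔖`. -/
abbrev Dec (𝔖 : Set (Set X)) (A : Set X) : Prop := HasPartition 𝔖 (fun _ => True) A

theorem IsPartition.subset {A : Set X} {𝔈 : Set (Set X)} (h : IsPartition 𝔖 A 𝔈) {E : Set X}
    (hE : E ∈ 𝔈) : E ⊆ A := fun x hx => (h.mem_iff x).2 ⟨E, hE, hx⟩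

theorem IsPartition.sUnion_eq {A : Set X} {𝔈 : Set (Set X)} (h : IsPartition 𝔖 A 𝔈) :
    ⋃₀ 𝔈 = A := by
  ext x; rw [h.mem_iff]; rfl

theorem IsPartition.isDecomposition {A : Set X} {𝔈 : Set (Set X)} (h : IsPartition 𝔖 A 𝔈) :
    IsDecomposition 𝔖 A 𝔈 := by
  refine ⟨h.sub, h.countable, fun E hE F hF hne => ?_, h.sUnion_eq⟩
  exact Set.disjoint_left.2 fun x hx hx' => hne (h.eq_of_mem E hE F hF x hx hx')

theorem IsDecomposition.isPartition {A : Set X} {𝔈 : Set (Set X)} (h : IsDecomposition 𝔖 A 𝔈)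
    (hne : ∀ E ∈ 𝔈, E.Nonempty) : IsPartition 𝔖 A 𝔈 := by
  obtain ⟨h1, h2, h3, h4⟩ := h
  refine ⟨h1, h2, hne, fun E hE F hF x hx hx' => ?_, fun x => by rw [← h4]; rfl⟩
  by_contra hEF
  exact Set.disjoint_left.1 (h3 hE hF hEF) hx hx'

theorem IsDecomposition.dec {A : Set X} {𝔈 : Set (Set X)} (h : IsDecomposition 𝔖 A 𝔈) :
    Dec 𝔖 A := by
  obtain ⟨h1, h2, h3, h4⟩ := h
  refine ⟨𝔈 \ {∅}, IsDecomposition.isPartition ⟨fun E hE => h1 hE.1, h2.mono Set.sdiff_subset,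
    h3.subset Set.sdiff_subset, ?_⟩ fun E hE => Set.nonempty_iff_ne_empty.2 hE.2, by simp⟩
  rw [Set.sUnion_sdiff_singleton_empty, h4]

theorem IsPartition.sep {A B : Set X} {𝔈 : Set (Set X)} (h : IsPartition 𝔖 A 𝔈) (p : Set X → Prop)
    (hB : ∀ x, x ∈ B ↔ ∃ E ∈ 𝔈, p E ∧ x ∈ E) : IsPartition 𝔖 B {E ∈ 𝔈 | p E} where
  sub E hE := h.sub hE.1
  countable := h.countable.mono fun E hE => hE.1
  nonempty E hE := h.nonempty E hE.1
  eq_of_mem E hE F hF := h.eq_of_mem E hE.1 F hF.1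
  mem_iff x := by rw [hB]; simp [and_assoc]

theorem isPartition_iUnion {ι : Type*} [Countable ι] {A : ι → Set X} {𝔈 : ι → Set (Set X)}
    (hd : ∀ i j x, x ∈ A i → x ∈ A j → i = j) (h : ∀ i, IsPartition 𝔖 (A i) (𝔈 i)) :
    IsPartition 𝔖 (⋃ i, A i) (⋃ i, 𝔈 i) where
  sub := Set.iUnion_subset fun i => (h i).sub
  countable := Set.countable_iUnion fun i => (h i).countable
  nonempty E hE := by
    obtain ⟨i, hi⟩ := Set.mem_iUnion.1 hE
    exact (h i).nonempty E hi
  eq_of_mem E hE F hF x hx hx' := by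
    obtain ⟨i, hi⟩ := Set.mem_iUnion.1 hE
    obtain ⟨j, hj⟩ := Set.mem_iUnion.1 hF
    obtain rfl := hd i j x ((h i).subset hi hx) ((h j).subset hj hx')
    exact (h i).eq_of_mem E hi F hj x hx hx'
  mem_iff x := by
    simp only [Set.mem_iUnion, (h _).mem_iff]
    exact ⟨fun ⟨i, E, h1, h2⟩ => ⟨E, ⟨i, h1⟩, h2⟩, fun ⟨E, ⟨i, h1⟩, h2⟩ => ⟨i, E, h1, h2⟩⟩

theorem IsPartition.union {A B : Set X} {𝔈 𝔉 : Set (Set X)} (hA : IsPartition 𝔖 A 𝔈)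
    (hB : IsPartition 𝔖 B 𝔉) (hd : Disjoint A B) : IsPartition 𝔖 (A ∪ B) (𝔈 ∪ 𝔉) := by
  have := isPartition_iUnion (𝔖 := 𝔖) (ι := Bool) (A := fun b => cond b A B)
    (𝔈 := fun b => cond b 𝔈 𝔉) ?_ ?_
  · simpa [Set.union_eq_iUnion] using this
  · rintro (_ | _) (_ | _) x h h' <;> simp only [cond_true, cond_false] at h h' ⊢
    · exact (Set.disjoint_left.1 hd h' h).elim
    · exact (Set.disjoint_left.1 hd h h').elim
  · rintro (_ | _) <;> assumption

theorem HasPartition.iUnion {ι : Type*} [Countable ι] {p : Set X → Prop} {A : ι → Set X}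
    (hd : ∀ i j x, x ∈ A i → x ∈ A j → i = j) (h : ∀ i, HasPartition 𝔖 p (A i)) :
    HasPartition 𝔖 p (⋃ i, A i) := by
  choose 𝔈 h1 h2 using h
  refine ⟨_, isPartition_iUnion hd h1, fun E hE => ?_⟩
  obtain ⟨i, hi⟩ := Set.mem_iUnion.1 hE
  exact h2 i E hi

theorem HasPartition.union {p : Set X → Prop} {A B : Set X} (hA : HasPartition 𝔖 p A)
    (hB : HasPartition 𝔖 p B) (hd : Disjoint A B) : HasPartition 𝔖 p (A ∪ B) := by
  obtain ⟨𝔈, h1, h2⟩ := hA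
  obtain ⟨𝔉, h3, h4⟩ := hB
  exact ⟨_, h1.union h3 hd, fun E hE => hE.elim (h2 E) (h4 E)⟩

theorem HasPartition.mono {p q : Set X → Prop} {A : Set X} (h : HasPartition 𝔖 p A)
    (hpq : ∀ E ∈ 𝔖, E ⊆ A → E.Nonempty → p E → q E) : HasPartition 𝔖 q A := by
  obtain ⟨𝔈, h1, h2⟩ := h
  exact ⟨𝔈, h1, fun E hE => hpq E (h1.sub hE) (h1.subset hE) (h1.nonempty E hE) (h2 E hE)⟩

theorem HasPartition.dec {p : Set X → Prop} {A : Set X} (h : HasPartition 𝔖 p A) : Dec 𝔖 A :=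
  h.mono fun _ _ _ _ _ => trivial

/-- Partitions are refined cell by cell: it suffices to partition the trace of `A` on each cell of a
partition of `B`. All refinement arguments below reduce to this. -/
theorem HasPartition.inter_bind {p q : Set X → Prop} {A B : Set X} (h : HasPartition 𝔖 p B)
    (hq : ∀ E ∈ 𝔖, E ⊆ B → E.Nonempty → p E → HasPartition 𝔖 q (A ∩ E)) :
    HasPartition 𝔖 q (A ∩ B) := by
  obtain ⟨𝔈, h1, h2⟩ := h
  have := h1.countable.to_subtype
  have key := HasPartition.iUnion (𝔖 := 𝔖) (p := q) (ι := 𝔈) (A := fun E => A ∩ E)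
    (fun E F x hx hx' => Subtype.ext (h1.eq_of_mem _ E.2 _ F.2 x hx.2 hx'.2))
    (fun E => hq E (h1.sub E.2) (h1.subset E.2) (h1.nonempty _ E.2) (h2 _ E.2))
  rwa [← Set.inter_iUnion, ← Set.sUnion_eq_iUnion, h1.sUnion_eq] at key

theorem HasPartition.bind {p q : Set X → Prop} {A : Set X} (h : HasPartition 𝔖 p A)
    (hq : ∀ E ∈ 𝔖, E ⊆ A → E.Nonempty → p E → HasPartition 𝔖 q E) : HasPartition 𝔖 q A := by
  have := h.inter_bind (A := Set.univ) (q := q) (by simpa using hq)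
  simpa using this

theorem hasPartition_self {p : Set X → Prop} {A : Set X} (hA : A ∈ 𝔖) (hp : p A) :
    HasPartition 𝔖 p A := by
  rcases A.eq_empty_or_nonempty with rfl | hne
  · exact ⟨∅, ⟨by simp, by simp, by simp, by simp, by simp⟩, by simp⟩
  · exact ⟨{A}, ⟨by simpa, by simp, by simpa, by simp, by simp⟩, by simpa⟩

theorem dec_empty : Dec 𝔖 (∅ : Set X) :=
  ⟨∅, ⟨by simp, by simp, by simp, by simp, by simp⟩, by simp⟩

section IntervalSystem

variable (h𝔖 : IsIntervalSystem 𝔖)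
include h𝔖

theorem dec_inter_mem {A B : Set X} (hA : Dec 𝔖 A) (hB : B ∈ 𝔖) : Dec 𝔖 (A ∩ B) := by
  rw [Set.inter_comm]
  refine hA.inter_bind fun E hE _ _ _ => ?_
  obtain ⟨_, 𝔇, h⟩ := h𝔖 B hB E hE
  exact h.dec

theorem dec_diff_mem {A B : Set X} (hA : Dec 𝔖 A) (hB : B ∈ 𝔖) : Dec 𝔖 (A \ B) := by
  rw [Set.sdiff_eq, Set.inter_comm]
  refine hA.inter_bind fun E hE _ _ _ => ?_
  obtain ⟨⟨𝔇, h⟩, _⟩ := h𝔖 E hE B hB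
  rw [Set.inter_comm, ← Set.sdiff_eq]
  exact h.dec

/-- Finiteness is essential: removing infinitely many members of `𝔖` need not leave a decomposable
set. -/
theorem dec_diff_sUnion {A : Set X} {𝔇 : Set (Set X)} (hA : Dec 𝔖 A) (hf : 𝔇.Finite)
    (h𝔇 : 𝔇 ⊆ 𝔖) : Dec 𝔖 (A \ ⋃₀ 𝔇) := by
  induction 𝔇, hf using Set.Finite.induction_on with
  | empty => simpa using hA
  | @insert B 𝔇 _ _ ih =>
    have := dec_diff_mem h𝔖 (ih fun E hE => h𝔇 (Or.inr hE)) (h𝔇 (Or.inl rfl))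
    rwa [Set.sdiff_sdiff, Set.union_comm, ← Set.sUnion_insert] at this

/-- After enumeration, each set minus its finitely many predecessors is decomposable, and these
differences are disjoint. The cells obtained lie inside members of the given family. -/
theorem hasPartition_sUnion {𝔇 : Set (Set X)} (hc : 𝔇.Countable) (h𝔇 : 𝔇 ⊆ 𝔖) :
    HasPartition 𝔖 (fun E => ∃ G ∈ 𝔇, E ⊆ G) (⋃₀ 𝔇) := by
  rcases 𝔇.eq_empty_or_nonempty with rfl | hne
  · simpa using dec_empty.mono fun E _ h1 h2 _ => (h2.ne_empty (Set.subset_empty_iff.1 h1)).elim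
  obtain ⟨G, rfl⟩ := hc.exists_eq_range hne
  rw [Set.sUnion_range, ← iUnion_disjointed]
  refine HasPartition.iUnion (fun i j x hi hj => ?_) fun n => ?_
  · by_contra hij
    exact Set.disjoint_left.1 (disjoint_disjointed G hij) hi hj
  · have h1 : disjointed G n = G n \ ⋃₀ (G '' Set.Iio n) := by
      ext x; simp [disjointed_eq_inter_compl]
    rw [h1]
    refine (dec_diff_sUnion h𝔖 (hasPartition_self (h𝔇 ⟨n, rfl⟩) trivial)
      ((Set.finite_Iio n).image _) ?_).mono fun E _ hE _ _ => ⟨G n, ⟨n, rfl⟩, hE.trans Set.sdiff_subset⟩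
    rintro _ ⟨m, _, rfl⟩
    exact h𝔇 ⟨m, rfl⟩

theorem dec_of_mem_sigmaSets {A : Set X} (hA : A ∈ sigmaSets 𝔖) : Dec 𝔖 A := by
  obtain ⟨𝔇, h1, h2, rfl⟩ := hA
  exact (hasPartition_sUnion h𝔖 h2 h1).dec

theorem Dec.subordinate {A : Set X} (hA : Dec 𝔖 A) {𝔇 : Set (Set X)} (hc : 𝔇.Countable)
    (h𝔇 : 𝔇 ⊆ 𝔖) (hsub : A ⊆ ⋃₀ 𝔇) : HasPartition 𝔖 (fun E => ∃ G ∈ 𝔇, E ⊆ G) A := by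
  have := (hasPartition_sUnion h𝔖 hc h𝔇).inter_bind (A := A) (q := fun E => ∃ G ∈ 𝔇, E ⊆ G) ?_
  · rwa [Set.inter_eq_left.2 hsub] at this
  · rintro E hE _ _ ⟨G, hG, hEG⟩
    exact (dec_inter_mem h𝔖 hA hE).mono
      fun F _ hF _ _ => ⟨G, hG, (hF.trans Set.inter_subset_right).trans hEG⟩

theorem HasPartition.split {A : Set X} {p : Set X → Prop} (hp : ∀ E F, F ⊆ E → p E → p F)
    (hA : HasPartition 𝔖 p A) {𝔇 : Set (Set X)} (hf : 𝔇.Finite) (h𝔇 : 𝔇 ⊆ 𝔖) :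
    HasPartition 𝔖 (fun E => p E ∧ ∀ D ∈ 𝔇, E ⊆ D ∨ Disjoint E D) A := by
  induction 𝔇, hf using Set.Finite.induction_on with
  | empty => simpa using hA
  | @insert B 𝔇 _ _ ih =>
    refine (ih fun E hE => h𝔇 (Or.inr hE)).bind fun E hE _ _ hpE => ?_
    have hEd : Dec 𝔖 E := hasPartition_self hE trivial
    have hB := h𝔇 (Or.inl rfl)
    have h1 : ∀ F ⊆ E, p F ∧ ∀ D ∈ 𝔇, F ⊆ D ∨ Disjoint F D := fun F hF =>
      ⟨hp E F hF hpE.1, fun D hD => (hpE.2 D hD).imp hF.trans fun h => h.mono_left hF⟩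
    have := ((dec_inter_mem h𝔖 hEd hB).mono
      (q := fun E => p E ∧ ∀ D ∈ insert B 𝔇, E ⊆ D ∨ Disjoint E D) ?_).union
      ((dec_diff_mem h𝔖 hEd hB).mono ?_) Set.disjoint_sdiff_inter.symm
    · rwa [Set.inter_union_sdiff] at this
    · intro F _ hF _ _
      refine ⟨(h1 F (hF.trans Set.inter_subset_left)).1, ?_⟩
      rintro D (rfl | hD)
      · exact Or.inl (hF.trans Set.inter_subset_right)
      · exact (h1 F (hF.trans Set.inter_subset_left)).2 D hD
    · intro F _ hF _ _
      refine ⟨(h1 F (hF.trans Set.sdiff_subset)).1, ?_⟩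
      rintro D (rfl | hD)
      · exact Or.inr (Set.disjoint_sdiff_left.mono_left hF)
      · exact (h1 F (hF.trans Set.sdiff_subset)).2 D hD

end IntervalSystem

end Partitions

/-! ### Gauges with countably many values. -/

section Gauges

variable {X : Type*} {𝔖 : Set (Set X)}

/-- A map assigning to each point of `A` one of countably many members of `𝔖` containing it. -/
structure IsGauge (𝔖 : Set (Set X)) (A : Set X) (r : X → Set X) : Prop where
  mem : ∀ x ∈ A, r x ∈ 𝔖
  self_mem : ∀ x ∈ A, x ∈ r x
  countable : (r '' A).Countable

theorem IsGauge.mono {A B : Set X} {r : X → Set X} (h : IsGauge 𝔖 A r) (hB : B ⊆ A) :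
    IsGauge 𝔖 B r :=
  ⟨fun x hx => h.mem x (hB hx), fun x hx => h.self_mem x (hB hx),
    h.countable.mono (Set.image_mono hB)⟩

theorem isGauge_const {A : Set X} (hA : A ∈ 𝔖) : IsGauge 𝔖 A fun _ => A :=
  ⟨fun _ _ => hA, fun _ hx => hx, (Set.countable_singleton A).mono (by simp)⟩

theorem IsPartition.exists_gauge {A : Set X} {𝔈 : Set (Set X)} (h : IsPartition 𝔖 A 𝔈) :
    ∃ r, IsGauge 𝔖 A r ∧ ∀ x ∈ A, r x ∈ 𝔈 := by
  have h1 : ∀ x ∈ A, ∃ E ∈ 𝔈, x ∈ E := fun x hx => (h.mem_iff x).1 hx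
  choose! r h2 h3 using h1
  exact ⟨r, ⟨fun x hx => h.sub (h2 x hx), h3, h.countable.mono (Set.image_subset_iff.2 h2)⟩, h2⟩

variable (h𝔖 : IsIntervalSystem 𝔖)
include h𝔖

/-- One decomposition of `G ∩ H` is fixed for each pair of values `G`, `H`, not for each point. The
common refinement therefore takes only countably many values. -/
theorem IsGauge.inf {A : Set X} {r₁ r₂ : X → Set X} (h₁ : IsGauge 𝔖 A r₁) (h₂ : IsGauge 𝔖 A r₂) :
    ∃ r, IsGauge 𝔖 A r ∧ ∀ x ∈ A, r x ⊆ r₁ x ∩ r₂ x := by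
  have h3 : ∀ G ∈ 𝔖, ∀ H ∈ 𝔖, ∃ 𝔇, IsDecomposition 𝔖 (G ∩ H) 𝔇 := fun G hG H hH => (h𝔖 G hG H hH).2
  choose! d hd using h3
  have h4 : ∀ x ∈ A, ∃ E ∈ d (r₁ x) (r₂ x), x ∈ E := fun x hx => by
    have h5 := (hd _ (h₁.mem x hx) _ (h₂.mem x hx)).2.2.2
    have : x ∈ ⋃₀ d (r₁ x) (r₂ x) := h5 ▸ ⟨h₁.self_mem x hx, h₂.self_mem x hx⟩
    exact this
  choose! r h5 h6 using h4
  refine ⟨r, ⟨fun x hx => (hd _ (h₁.mem x hx) _ (h₂.mem x hx)).1 (h5 x hx), h6, ?_⟩,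
    fun x hx => ?_⟩
  · refine Set.Countable.mono (s₂ := ⋃ G ∈ r₁ '' A, ⋃ H ∈ r₂ '' A, d G H) ?_ ?_
    · rintro _ ⟨x, hx, rfl⟩
      simp only [Set.mem_iUnion]
      exact ⟨_, ⟨x, hx, rfl⟩, _, ⟨x, hx, rfl⟩, h5 x hx⟩
    · refine h₁.countable.biUnion ?_
      rintro _ ⟨x, hx, rfl⟩
      refine h₂.countable.biUnion ?_
      rintro _ ⟨y, hy, rfl⟩
      exact (hd _ (h₁.mem x hx) _ (h₂.mem y hy)).2.1
  · rw [← (hd _ (h₁.mem x hx) _ (h₂.mem x hx)).2.2.2]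
    exact Set.subset_sUnion_of_mem (h5 x hx)

theorem IsGauge.hasPartition {A : Set X} {r : X → Set X} (h : IsGauge 𝔖 A r) (hA : Dec 𝔖 A) :
    HasPartition 𝔖 (fun E => ∃ x ∈ A, E ⊆ r x) A := by
  refine (hA.subordinate h𝔖 h.countable (Set.image_subset_iff.2 h.mem)
    fun x hx => ⟨r x, ⟨x, hx, rfl⟩, h.self_mem x hx⟩).mono ?_
  rintro E _ _ _ ⟨_, ⟨x, hx, rfl⟩, hE⟩
  exact ⟨x, hx, hE⟩

end Gauges

/-! ### Riemann sums along gauges, and the filters expressed through them. -/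

section Controls

variable {X V W Z : Type*}

/-- The finite sums of `g` over `𝔈` lie eventually in `T`. -/
def EvIn [AddCommMonoid Z] (𝔈 : Set (Set X)) (g : Set X → Z) (T : Set Z) : Prop :=
  ∃ Ξ : Finset (Set X), ↑Ξ ⊆ 𝔈 ∧ ∀ Ω : Finset (Set X), Ξ ⊆ Ω → ↑Ω ⊆ 𝔈 → ∑ E ∈ Ω, g E ∈ T

/-- `v` is the value of `f` at a tag in `A` to which the gauge `r` allows to attach `E`. -/
def Adm (f : X → V) (A : Set X) (r : X → Set X) (E : Set X) (v : V) : Prop :=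
  ∃ x ∈ A, E ⊆ r x ∧ v = f x

theorem Adm.mono {f : X → V} {A B : Set X} {r s : X → Set X} {E F : Set X} {v : V}
    (h : Adm f A r E v) (hAB : A ⊆ B) (hrs : ∀ x ∈ A, r x ⊆ s x) (hF : F ⊆ E) : Adm f B s F v := by
  obtain ⟨x, hx, h1, h2⟩ := h
  exact ⟨x, hAB hx, (hF.trans h1).trans (hrs x hx), h2⟩

variable [AddCommGroup V] [AddCommGroup W] [AddCommGroup Z]

/-- The Riemann sums over the partitions subordinate to the gauge `r` on `A` lie eventually
in `T`. -/
structure Controls (L : V →+ W →+ Z) (𝔖 : Set (Set X)) (μ : Set X → W) (f : X → V)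
    (A : Set X) (T : Set Z) (r : X → Set X) : Prop where
  isGauge : IsGauge 𝔖 A r
  evIn : ∀ (𝔈 : Set (Set X)) (v : Set X → V), IsPartition 𝔖 A 𝔈 →
    (∀ E ∈ 𝔈, Adm f A r E (v E)) → EvIn 𝔈 (fun E => L (v E) (μ E)) T

variable {L : V →+ W →+ Z} {𝔖 : Set (Set X)} {μ : Set X → W} {f : X → V}

theorem Controls.refine {A : Set X} {r s : X → Set X} {T : Set Z} (h : Controls L 𝔖 μ f A T r)
    (hs : IsGauge 𝔖 A s) (hsr : ∀ x ∈ A, s x ⊆ r x) : Controls L 𝔖 μ f A T s :=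
  ⟨hs, fun 𝔈 v h1 h2 => h.evIn 𝔈 v h1 fun E hE => (h2 E hE).mono subset_rfl hsr subset_rfl⟩

theorem formalSum_mem_iff {ι : Type*} {G : Type*} [AddCommMonoid G] (u : ι → G) (S : Set G) :
    S ∈ formalSumFilter u ↔ ∃ Ξ : Finset ι, ∀ Ω, Ξ ⊆ Ω → ∑ i ∈ Ω, u i ∈ S := by
  rw [formalSumFilter, mem_map, mem_atTop_sets]
  rfl

theorem exists_finset_subtype_iff {𝔈 : Set (Set X)} {g : Set X → Z} {T : Set Z} :
    EvIn 𝔈 g T ↔ ∃ Ξ : Finset 𝔈, ∀ Ω, Ξ ⊆ Ω → ∑ E ∈ Ω, g E ∈ T := by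
  classical
  constructor
  · rintro ⟨Ξ, h1, h2⟩
    refine ⟨Ξ.subtype (· ∈ 𝔈), fun Ω hΩ => ?_⟩
    have := h2 (Ω.map (Function.Embedding.subtype _)) ?_ ?_
    · simpa using this
    · intro E hE
      simpa [h1 hE] using hΩ (Finset.mem_subtype.2 hE : (⟨E, h1 hE⟩ : 𝔈) ∈ _)
    · intro E hE
      simp only [Finset.coe_map, Function.Embedding.subtype_apply, Set.mem_image] at hE
      obtain ⟨F, _, rfl⟩ := hE
      exact F.2
  · rintro ⟨Ξ, h⟩
    refine ⟨Ξ.map (Function.Embedding.subtype _), ?_, fun Ω h1 h2 => ?_⟩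
    · intro E hE
      simp only [Finset.coe_map, Function.Embedding.subtype_apply, Set.mem_image] at hE
      obtain ⟨F, _, rfl⟩ := hE
      exact F.2
    · have := h (Ω.subtype (· ∈ 𝔈)) ?_
      · rwa [Finset.sum_subtype_of_mem _ fun E hE => h2 hE] at this
      · intro E hE
        rw [Finset.mem_subtype]
        exact h1 (Finset.mem_map_of_mem (Function.Embedding.subtype _) hE)

theorem TaggedDivision.preimage_mem_filter_iff {D : TagSystem 𝔖} (P : TaggedDivision D)
    (T : Set Z) (v : Set X → V) (hv : ∀ E : P.sets, v E = f (P.c E)) :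
    evalFormal L μ f ⁻¹' T ∈ P.filter ↔ EvIn P.sets (fun E => L (v E) (μ E)) T := by
  rw [TaggedDivision.filter, formalSum_mem_iff, exists_finset_subtype_iff]
  simp [evalFormal, hv]

/-- The gauge of a tag system. -/
def TagSystem.gauge (D : TagSystem 𝔖) (x : X) : Set X :=
  open Classical in if h : x ∈ ⋃₀ D.sets then D.h ⟨x, h⟩ else ∅

theorem TagSystem.gauge_eq (D : TagSystem 𝔖) (x : ↥(⋃₀ D.sets)) : D.gauge x = D.h x := by
  simp only [TagSystem.gauge]
  rw [dif_pos x.2]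

theorem TagSystem.isGauge (D : TagSystem 𝔖) : IsGauge 𝔖 D.support D.gauge where
  mem x hx := by
    rw [D.gauge_eq ⟨x, hx⟩]; exact D.sets_subset (D.h_mem _)
  self_mem x hx := by
    rw [D.gauge_eq ⟨x, hx⟩]; exact D.mem_h ⟨x, hx⟩
  countable := by
    refine D.countable.mono ?_
    rintro _ ⟨x, hx, rfl⟩
    rw [D.gauge_eq ⟨x, hx⟩]; exact D.h_mem _

theorem TagSystem.controls {D : TagSystem 𝔖} {T : Set Z}
    (h : evalFormal L μ f ⁻¹' T ∈ D.filter) : Controls L 𝔖 μ f D.support T D.gauge := by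
  refine ⟨D.isGauge, fun 𝔈 v h1 h2 => ?_⟩
  choose c hc1 hc2 hc3 using h2
  let P : TaggedDivision D :=
    { sets := 𝔈
      isDecomposition := h1.isDecomposition
      nonempty := h1.nonempty
      c := fun E => ⟨c E E.2, hc1 E E.2⟩
      subset_h := fun E => by
        rw [← D.gauge_eq]; exact hc2 E E.2 }
  exact (P.preimage_mem_filter_iff T v fun E => hc3 E E.2).1 (Filter.mem_iSup.1 h P)

theorem IsGauge.exists_tagSystem {A : Set X} {r : X → Set X} (h : IsGauge 𝔖 A r)
    (hr : ∀ x ∈ A, r x ⊆ A) :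
    ∃ D : TagSystem 𝔖, D.support = A ∧ ∀ x, D.h x = r x := by
  have hA : ⋃₀ (r '' A) = A := by
    apply Set.Subset.antisymm
    · exact Set.sUnion_subset (by rintro _ ⟨x, hx, rfl⟩; exact hr x hx)
    · exact fun x hx => ⟨r x, ⟨x, hx, rfl⟩, h.self_mem x hx⟩
  exact ⟨⟨r '' A, Set.image_subset_iff.2 h.mem, h.countable, fun x => r x,
    fun x => ⟨x, hA.subset x.2, rfl⟩, fun x => h.self_mem x (hA.subset x.2)⟩, hA, fun _ => rfl⟩

theorem Controls.mem_filter {D : TagSystem 𝔖} {r : X → Set X} {T : Set Z} (hD : ∀ x, D.h x = r x)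
    (h : Controls L 𝔖 μ f D.support T r) : evalFormal L μ f ⁻¹' T ∈ D.filter := by
  classical
  refine Filter.mem_iSup.2 fun P => ?_
  refine (P.preimage_mem_filter_iff T (fun E => if h : E ∈ P.sets then f (P.c ⟨E, h⟩) else 0)
    fun E => by rw [dif_pos E.2]).2 (h.evIn _ _ (P.isDecomposition.isPartition P.nonempty) ?_)
  intro E hE
  refine ⟨P.c ⟨E, hE⟩, (P.c ⟨E, hE⟩).2, ?_, by rw [dif_pos hE]⟩
  rw [← hD]
  exact P.subset_h ⟨E, hE⟩

section

variable (h𝔖 : IsIntervalSystem 𝔖)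
include h𝔖

/-- Shrinking the values of the gauge into `A` makes their union exactly `A`, as a tag system
supported on `A` requires. -/
theorem Controls.exists_subset {A : Set X} (hA : Dec 𝔖 A) {r : X → Set X} {T : Set Z}
    (h : Controls L 𝔖 μ f A T r) : ∃ s, Controls L 𝔖 μ f A T s ∧ ∀ x ∈ A, s x ⊆ r x ∩ A := by
  obtain ⟨𝔈, h1, _⟩ := hA
  obtain ⟨r', h2, h3⟩ := h1.exists_gauge
  obtain ⟨s, h4, h5⟩ := h.isGauge.inf h𝔖 h2
  exact ⟨s, h.refine h4 fun x hx => (h5 x hx).trans Set.inter_subset_left, fun x hx =>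
    (h5 x hx).trans (Set.inter_subset_inter_right _ (h1.subset (h3 x hx)))⟩

/-- Two tag systems on `A` have a common refinement, and refining admits fewer divisions. The
infimum is thus directed, and membership in it is membership in the filter of a single tag system. A
partition of `A` shows that tag systems exist at all. -/
theorem preimage_mem_lmFilter_iff {A : Set X} (hA : Dec 𝔖 A) {T : Set Z} :
    evalFormal L μ f ⁻¹' T ∈ lmFilter 𝔖 A ↔ ∃ r, Controls L 𝔖 μ f A T r := by
  have hfil : ∀ D D' : TagSystem 𝔖, (∀ x (hx : x ∈ D.support) (hx' : x ∈ D'.support),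
      D.h ⟨x, hx⟩ ⊆ D'.h ⟨x, hx'⟩) → D.support = D'.support → D.filter ≤ D'.filter := by
    intro D D' h1 h2
    refine iSup_le fun P => ?_
    let P' : TaggedDivision D' :=
      { sets := P.sets
        isDecomposition := h2 ▸ P.isDecomposition
        nonempty := P.nonempty
        c := fun E => ⟨P.c E, h2.subset (P.c E).2⟩
        subset_h := fun E => (P.subset_h E).trans (h1 _ (P.c E).2 (h2.subset (P.c E).2)) }
    exact le_iSup (fun P : TaggedDivision D' => P.filter) P'
  refine (Filter.mem_biInf_of_directed (s := {D : TagSystem 𝔖 | D.support = A})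
    (f := TagSystem.filter) ?_ ?_).trans ?_
  rotate_left 2
  · constructor
    · rintro ⟨D, rfl, h⟩
      exact ⟨_, TagSystem.controls h⟩
    · rintro ⟨r, h⟩
      obtain ⟨s, h1, h2⟩ := h.exists_subset h𝔖 hA
      obtain ⟨D, rfl, h3⟩ := h1.isGauge.exists_tagSystem fun x hx => (h2 x hx).trans
        Set.inter_subset_right
      exact ⟨D, rfl, h1.mem_filter h3⟩
  · rintro D hD D' hD'
    have hD : D.support = A := hD
    have hD' : D'.support = A := hD'
    obtain ⟨𝔈, h1, _⟩ := hA
    obtain ⟨q, h2, h3⟩ := h1.exists_gauge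
    obtain ⟨s, h4, h5⟩ := (hD ▸ D.isGauge).inf h𝔖 (hD' ▸ D'.isGauge)
    obtain ⟨s', h6, h7⟩ := h4.inf h𝔖 h2
    obtain ⟨D'', h8, h9⟩ := h6.exists_tagSystem fun x hx => (h7 x hx).trans
      (Set.inter_subset_right.trans (h1.subset (h3 x hx)))
    refine ⟨D'', h8, hfil _ _ (fun x hx hx' => ?_) (h8.trans hD.symm),
      hfil _ _ (fun x hx hx' => ?_) (h8.trans hD'.symm)⟩
    · rw [h9, ← D.gauge_eq]
      exact ((h7 x (h8 ▸ hx)).trans Set.inter_subset_left).trans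
        ((h5 x (h8 ▸ hx)).trans Set.inter_subset_left)
    · rw [h9, ← D'.gauge_eq]
      exact ((h7 x (h8 ▸ hx)).trans Set.inter_subset_left).trans
        ((h5 x (h8 ▸ hx)).trans Set.inter_subset_right)
  · obtain ⟨𝔈, h1, _⟩ := hA
    obtain ⟨q, h2, h3⟩ := h1.exists_gauge
    obtain ⟨D, h4, _⟩ := h2.exists_tagSystem fun x hx => h1.subset (h3 x hx)
    exact ⟨D, h4⟩

end

/-- Intersections of two tops are tops, so the infimum is directed. For fixed `T`, the indices
beyond which every filter contains the preimage of `T` form an upward closed set, and the right-hand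
side says that this set is cofinal. -/
theorem tendsto_limitFilter_iff {P β γ : Type*} {r : P → P → Prop} (hr : ∀ p, r p p)
    (ht : ∀ p q s, r p q → r q s → r p s) (F : P → Filter β) (φ : β → γ) (G : Filter γ) :
    Tendsto φ (limitFilter r F) G ↔
      ∀ T ∈ G, ∀ p, ∃ q, r p q ∧ ∀ s, r q s → φ ⁻¹' T ∈ F s := by
  have key : ∀ S, S ∈ limitFilter r F ↔ ∃ U, IsTopSet r U ∧ ∀ p ∈ U, S ∈ F p := by
    intro S
    refine (Filter.mem_biInf_of_directed (s := {U : Set P | IsTopSet r U})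
      (f := fun U => ⨆ p ∈ U, F p) ?_ ?_).trans ?_
    rotate_left 2
    · simp [Filter.mem_iSup]
    · rintro U hU U' hU'
      refine ⟨U ∩ U', ⟨fun p => ?_, fun s hs t hst => ⟨hU.2 s hs.1 t hst, hU'.2 s hs.2 t hst⟩⟩,
        biSup_mono fun _ h => h.1, biSup_mono fun _ h => h.2⟩
      obtain ⟨s, h1, h2⟩ := hU.1 p
      obtain ⟨t, h3, h4⟩ := hU'.1 s
      exact ⟨t, ⟨hU.2 s h1 t h4, h3⟩, ht _ _ _ h2 h4⟩
    · exact ⟨Set.univ, fun p => ⟨p, trivial, hr p⟩, fun _ _ _ _ => trivial⟩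
  simp only [Tendsto, Filter.le_def, mem_map, key]
  refine forall₂_congr fun T hT => ⟨?_, fun h => ?_⟩
  · rintro ⟨U, h1, h2⟩ p
    obtain ⟨s, h3, h4⟩ := h1.1 p
    exact ⟨s, h4, fun t hst => h2 t (h1.2 s h3 t hst)⟩
  · refine ⟨{q | ∀ s, r q s → φ ⁻¹' T ∈ F s}, ⟨fun p => ?_, fun s hs t hst u htu =>
      hs u (ht _ _ _ hst htu)⟩, fun p hp => hp p (hr p)⟩
    obtain ⟨q, h1, h2⟩ := h p
    exact ⟨q, h2, h1⟩

end Controls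

/-! ### Step functions and their integrals over countable partitions. -/

section StepFunctions

variable {X V W Z : Type*} [AddCommGroup V] [AddCommGroup W] [AddCommGroup Z]
variable {L : V →+ W →+ Z} {𝔖 : Set (Set X)} {μ : Set X → W}

theorem HasPartition.exists_val {β : Type*} [Nonempty β] {q : Set X → β → Prop} {A : Set X}
    (h : HasPartition 𝔖 (fun E => ∃ v, q E v) A) :
    ∃ (𝔈 : Set (Set X)) (v : Set X → β), IsPartition 𝔖 A 𝔈 ∧ ∀ E ∈ 𝔈, q E (v E) := by
  obtain ⟨𝔈, h1, h2⟩ := h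
  choose! v hv using h2
  exact ⟨𝔈, v, h1, hv⟩

theorem exists_stepFun_eq (Ω : Finset (Set X)) (v : Set X → V) (hΩ : ↑Ω ⊆ 𝔖) :
    ∃ (n : ℕ) (c : Fin n → V) (E : Fin n → Set X), (∀ j, E j ∈ 𝔖) ∧
      (stepFun c E = fun x => ∑ F ∈ Ω, F.indicator (fun _ => v F) x) ∧
      ∑ j, L (c j) (μ (E j)) = ∑ F ∈ Ω, L (v F) (μ F) := by
  refine ⟨Ω.card, fun j => v (Ω.equivFin.symm j), fun j => Ω.equivFin.symm j,
    fun j => hΩ (Ω.equivFin.symm j).2, ?_, ?_⟩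
  · ext x
    rw [stepFun, ← Finset.sum_coe_sort Ω]
    exact Ω.equivFin.symm.sum_comp fun F : Ω => (F : Set X).indicator (fun _ => v F) x
  · rw [← Finset.sum_coe_sort Ω]
    exact Ω.equivFin.symm.sum_comp fun F : Ω => L (v F) (μ F)

theorem stepFun_append {m n : ℕ} (c : Fin m → V) (d : Fin n → V) (E : Fin m → Set X)
    (F : Fin n → Set X) (x : X) :
    stepFun (Fin.append c d) (Fin.append E F) x = stepFun c E x + stepFun d F x := by
  simp [stepFun, Fin.sum_univ_add]

theorem sum_indicator_of_mem {Ω : Finset (Set X)} {v : Set X → V} {E : Set X} {x : X}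
    (hE : E ∈ Ω) (hx : x ∈ E) (h : ∀ F ∈ Ω, x ∈ F → F = E) :
    ∑ F ∈ Ω, F.indicator (fun _ => v F) x = v E := by
  rw [Finset.sum_eq_single_of_mem E hE fun F hF hne =>
    Set.indicator_of_notMem (fun hx => hne (h F hF hx)) _, Set.indicator_of_mem hx]

theorem sum_indicator_of_notMem {Ω : Finset (Set X)} {v : Set X → V} {x : X}
    (h : ∀ F ∈ Ω, x ∉ F) : ∑ F ∈ Ω, F.indicator (fun _ => v F) x = 0 :=
  Finset.sum_eq_zero fun F hF => Set.indicator_of_notMem (h F hF) _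

theorem stepFun_eq_of_compat {n : ℕ} {c : Fin n → V} {E : Fin n → Set X} {F : Set X}
    (hF : ∀ D ∈ Set.range E, F ⊆ D ∨ Disjoint F D) {x y : X} (hx : x ∈ F) (hy : y ∈ F) :
    stepFun c E x = stepFun c E y := by
  refine Finset.sum_congr rfl fun j _ => ?_
  rcases hF _ ⟨j, rfl⟩ with h | h
  · rw [Set.indicator_of_mem (h hx), Set.indicator_of_mem (h hy)]
  · rw [Set.indicator_of_notMem (Set.disjoint_left.1 h hx),
      Set.indicator_of_notMem (Set.disjoint_left.1 h hy)]

theorem stepFun_eq_zero {n : ℕ} {c : Fin n → V} {E : Fin n → Set X} {x : X}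
    (hx : x ∉ ⋃₀ Set.range E) : stepFun c E x = 0 :=
  Finset.sum_eq_zero fun j _ => Set.indicator_of_notMem (fun h => hx ⟨_, ⟨j, rfl⟩, h⟩) _

/-- Every set with a partition has one into sets on which a given step function is constant. -/
theorem HasPartition.stepFun (h𝔖 : IsIntervalSystem 𝔖) {A : Set X} {p : Set X → Prop}
    (hp : ∀ E F, F ⊆ E → p E → p F) (hA : HasPartition 𝔖 p A) {n : ℕ} (c : Fin n → V)
    {E : Fin n → Set X} (hE : ∀ j, E j ∈ 𝔖) :
    HasPartition 𝔖 (fun F => p F ∧ ∃ u, ∀ x ∈ F, stepFun c E x = u) A := by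
  refine (hA.split h𝔖 hp (Set.finite_range E) (Set.range_subset_iff.2 hE)).mono ?_
  rintro F _ _ ⟨x, hx⟩ ⟨h1, h2⟩
  exact ⟨h1, _, fun y hy => stepFun_eq_of_compat h2 hy hx⟩

/-- Countable modifications of a step function in `𝒜` have their sums in the bilinear sum. -/
theorem add_mem_preIntegral [TopologicalSpace Z] [IsTopologicalAddGroup Z]
    {𝒜 : Set (V × X)} {n : ℕ} {c : Fin n → V}
    {E : Fin n → Set X} (hE : ∀ j, E j ∈ 𝔖) (hg : graph (stepFun c E) ⊆ 𝒜) {A : Set X} {𝔉 : Set (Set X)}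
    (h𝔉 : IsPartition 𝔖 A 𝔉) {u v : Set X → V} (hu : ∀ F ∈ 𝔉, ∀ x ∈ F, stepFun c E x = u F)
    (hv : ∀ F ∈ 𝔉, v F ∈ fibre 𝒜 F) {z : Z}
    (hz : HasSum (𝔉.indicator fun F => L (v F - u F) (μ F)) z) :
    ∑ j, L (c j) (μ (E j)) + z ∈ preIntegral L 𝔖 μ 𝒜 := by
  rw [← hasSum_subtype_iff_indicator] at hz
  -- For a finite set `Φ` of cells, adding `v F - u F` on each cell of `Φ` gives a genuine step
  -- function: it equals `v F` on these cells and the old function elsewhere, hence stays in `𝒜`.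
  -- The closure absorbs the limit over `Φ`.
  refine mem_closure_of_tendsto (hz.const_add _) (Eventually.of_forall fun Φ => ?_)
  obtain ⟨m, d, F, hF, h1, h2⟩ := exists_stepFun_eq (L := L) (μ := μ) (𝔖 := 𝔖)
    (Φ.map (Function.Embedding.subtype _)) (fun F => v F - u F) fun F hF => by
      simp only [Finset.coe_map, Function.Embedding.subtype_apply, Set.mem_image] at hF
      obtain ⟨F', _, rfl⟩ := hF
      exact h𝔉.sub F'.2
  refine ⟨n + m, Fin.append c d, Fin.append E F, fun j => ?_, ?_, ?_⟩
  · refine Fin.addCases (fun i => ?_) (fun i => ?_) j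
    · simpa using hE i
    · simpa using hF i
  · rintro ⟨y, x⟩ hy
    have hy : y = _ := hy
    simp only [stepFun_append, h1] at hy
    by_cases hx : ∃ F ∈ Φ, x ∈ (F : Set X)
    · obtain ⟨G, hG, hx⟩ := hx
      rw [sum_indicator_of_mem (Finset.mem_map_of_mem _ hG) hx, hu G G.2 x hx] at hy
      · simp only [Function.Embedding.subtype_apply, add_sub_cancel] at hy
        exact hy ▸ hv G G.2 x hx
      · intro G' hG' hx'
        obtain ⟨G', _, rfl⟩ := Finset.mem_map.1 hG'
        exact h𝔉.eq_of_mem _ G'.2 _ G.2 x hx' hx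
    · rw [sum_indicator_of_notMem, add_zero] at hy
      · exact hg hy
      · intro G hG hxG
        obtain ⟨G', hG', rfl⟩ := Finset.mem_map.1 hG
        exact hx ⟨G', hG', hxG⟩
  · simp only [Fin.sum_univ_add, Fin.append_left, Fin.append_right, h2]
    simp

section Measure

variable [TopologicalSpace W] [TopologicalSpace Z]

theorem IsMeasureOn.hasSum (hμ : IsMeasureOn 𝔖 μ) {A : Set X} (hA : A ∈ 𝔖) {𝔈 : Set (Set X)}
    (h : IsPartition 𝔖 A 𝔈) : HasSum (𝔈.indicator μ) (μ A) := by
  have := h.countable.to_subtype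
  have := Encodable.ofCountable 𝔈
  rw [← hasSum_subtype_iff_indicator]
  -- `IsMeasureOn` quantifies over index types in `Type`, while `𝔈` lives in the universe of `X`; a
  -- subset of `ℕ` serves as index set instead.
  let e := Encodable.equivRangeEncode 𝔈
  have hU : ⋃ i, ((e.symm i : 𝔈) : Set X) = A := by
    rw [← h.sUnion_eq, Set.sUnion_eq_iUnion]
    exact e.symm.surjective.iUnion_comp fun E : 𝔈 => (E : Set X)
  have h1 := hμ (Set.range (Encodable.encode : 𝔈 → ℕ)) (fun i => (e.symm i : 𝔈))
    (fun i => h.sub (e.symm i).2) (fun i j hij => Set.disjoint_left.2 fun x hx hx' => hij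
      (e.symm.injective (Subtype.ext (h.eq_of_mem _ (e.symm i).2 _ (e.symm j).2 x hx hx'))))
    (hU ▸ hA)
  rw [hU] at h1
  exact (e.symm.hasSum_iff (f := fun E : 𝔈 => μ E)).1 h1

theorem IsMeasureOn.hasSum_map (hμ : IsMeasureOn 𝔖 μ) (hL : ∀ v : V, Continuous (L v)) (v : V)
    {A : Set X} (hA : A ∈ 𝔖) {𝔈 : Set (Set X)} (h : IsPartition 𝔖 A 𝔈) :
    HasSum (𝔈.indicator fun E => L v (μ E)) (L v (μ A)) := by
  convert (hμ.hasSum hA h).map (L v) (hL v) using 1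
  ext E
  by_cases hE : E ∈ 𝔈 <;> simp [hE]

variable [IsTopologicalAddGroup Z]

/-- When the cells are compatible with every `E j`, those inside `E j` partition it. Additivity of
`μ` for each `j`, followed by adding the finitely many families, gives the result. -/
theorem hasSum_stepFun_of_compat (hμ : IsMeasureOn 𝔖 μ) (hL : ∀ v : V, Continuous (L v))
    {n : ℕ} {c : Fin n → V} {E : Fin n → Set X} (hE : ∀ j, E j ∈ 𝔖) {A : Set X}
    (hA : ∀ j, E j ⊆ A) {𝔉 : Set (Set X)} (h𝔉 : IsPartition 𝔖 A 𝔉)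
    (hc : ∀ F ∈ 𝔉, ∀ D ∈ Set.range E, F ⊆ D ∨ Disjoint F D)
    {u : Set X → V} (hu : ∀ F ∈ 𝔉, ∀ x ∈ F, stepFun c E x = u F) :
    HasSum (𝔉.indicator fun F => L (u F) (μ F)) (∑ j, L (c j) (μ (E j))) := by
  classical
  have h1 : ∀ j ∈ Finset.univ, HasSum ({F ∈ 𝔉 | F ⊆ E j}.indicator fun F => L (c j) (μ F))
      (L (c j) (μ (E j))) := by
    intro j _
    refine hμ.hasSum_map hL (c j) (hE j) (h𝔉.sep _ fun x => ⟨fun hx => ?_, ?_⟩)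
    · obtain ⟨F, hF, hxF⟩ := (h𝔉.mem_iff x).1 (hA j hx)
      refine ⟨F, hF, (hc F hF _ ⟨j, rfl⟩).resolve_right fun h => ?_, hxF⟩
      exact Set.disjoint_left.1 h hxF hx
    · rintro ⟨F, _, hF, hx⟩
      exact hF hx
  convert hasSum_sum h1 using 1
  ext F
  by_cases hF : F ∈ 𝔉
  · obtain ⟨x, hx⟩ := h𝔉.nonempty F hF
    rw [Set.indicator_of_mem hF, ← hu F hF x hx, stepFun, map_sum, AddMonoidHom.finsetSum_apply]
    refine Finset.sum_congr rfl fun j _ => ?_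
    by_cases hj : F ⊆ E j
    · simp [hF, hj, hj hx]
    · have := Set.disjoint_left.1 ((hc F hF _ ⟨j, rfl⟩).resolve_left hj) hx
      simp [hj, this]
  · simp [hF]

/-- The integral of a step function is the sum over any partition into sets of constancy. -/
theorem hasSum_stepFun [T2Space Z] (h𝔖 : IsIntervalSystem 𝔖) (hμ : IsMeasureOn 𝔖 μ)
    (hL : ∀ v : V, Continuous (L v))
    {n : ℕ} {c : Fin n → V} {E : Fin n → Set X} (hE : ∀ j, E j ∈ 𝔖) {A : Set X}
    {𝔉 : Set (Set X)} (h𝔉 : IsPartition 𝔖 A 𝔉)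
    {u : Set X → V} (hu : ∀ F ∈ 𝔉, ∀ x ∈ F, stepFun c E x = u F)
    (h0 : ∀ x ∉ A, stepFun c E x = 0) :
    HasSum (𝔉.indicator fun F => L (u F) (μ F)) (∑ j, L (c j) (μ (E j))) := by
  classical
  have hfin := Set.finite_range E
  have hsub : Set.range E ⊆ 𝔖 := Set.range_subset_iff.2 hE
  -- Only cells carrying a nonzero value must lie inside a member of `𝔉`: the sets `E j` may leave
  -- `A`, where their contributions cancel to zero.
  have hp : HasPartition 𝔖 (fun H => (∀ D ∈ Set.range E, H ⊆ D ∨ Disjoint H D) ∧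
      ∃ w, (∀ x ∈ H, stepFun c E x = w) ∧ (w ≠ 0 → ∃ F ∈ 𝔉, H ⊆ F)) (⋃₀ Set.range E) := by
    refine ((hasPartition_sUnion h𝔖 hfin.countable hsub).dec.split h𝔖 (fun _ _ _ h => h)
      hfin hsub).bind ?_
    rintro G hG - ⟨y, hy⟩ ⟨-, hGc⟩
    have hGc' : ∀ H ⊆ G, ∀ D ∈ Set.range E, H ⊆ D ∨ Disjoint H D := fun H hH D hD =>
      (hGc D hD).imp hH.trans fun h => h.mono_left hH
    have hconst : ∀ x ∈ G, stepFun c E x = stepFun c E y := fun x hx =>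
      stepFun_eq_of_compat hGc hx hy
    by_cases hw : stepFun c E y = 0
    · exact hasPartition_self hG ⟨hGc, _, hconst, fun h => (h hw).elim⟩
    · refine (Dec.subordinate h𝔖 (hasPartition_self hG trivial) h𝔉.countable
        h𝔉.sub fun x hx => ?_).mono fun H _ hH _ hF =>
          ⟨hGc' H hH, _, fun x hx => hconst x (hH hx), fun _ => hF⟩
      rw [h𝔉.sUnion_eq]
      by_contra hxA
      exact hw (hconst x hx ▸ h0 x hxA)
  obtain ⟨ℌ, hℌ, hp⟩ := hp
  have hc : ∀ H ∈ ℌ, ∀ D ∈ Set.range E, H ⊆ D ∨ Disjoint H D := fun H hH => (hp H hH).1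
  have hw : ∀ H ∈ ℌ, ∃ w, (∀ x ∈ H, stepFun c E x = w) ∧ (w ≠ 0 → ∃ F ∈ 𝔉, H ⊆ F) :=
    fun H hH => (hp H hH).2
  choose! w hw1 hw2 using hw
  have key := hasSum_stepFun_of_compat (L := L) (μ := μ) hμ hL hE
    (fun j => Set.subset_sUnion_of_mem (Set.mem_range_self j)) hℌ hc hw1
  set ℌ₁ : Set (Set X) := {H ∈ ℌ | w H ≠ 0}
  have key1 : HasSum (ℌ₁.indicator fun H => L (w H) (μ H)) (∑ j, L (c j) (μ (E j))) := by
    convert key using 1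
    ext H
    by_cases h1 : H ∈ ℌ <;> by_cases h2 : w H = 0 <;> simp [ℌ₁, h1, h2]
  rw [← hasSum_subtype_iff_indicator] at key1 ⊢
  have hpar : ∀ H : ℌ₁, ∃ F : 𝔉, (H : Set X) ⊆ F := fun H => by
    obtain ⟨F, hF, hHF⟩ := hw2 H H.2.1 H.2.2
    exact ⟨⟨F, hF⟩, hHF⟩
  choose par hpar using hpar
  -- The cells with nonzero value are regrouped according to the member of `𝔉` that contains them.
  have key2 := (Equiv.sigmaFiberEquiv par).hasSum_iff.2 key1
  refine key2.sigma fun F => ?_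
  have huw : ∀ H : ℌ₁, par H = F → w H = u F := by
    rintro H rfl
    obtain ⟨x, hx⟩ := hℌ.nonempty H H.2.1
    rw [← hw1 H H.2.1 x hx, hu _ (par H).2 x (hpar H hx)]
  -- If `u F = 0`, no retained cell lies in `F`, and the term is `0`. Otherwise the retained cells
  -- inside `F` partition `F`.
  by_cases huF : u F = 0
  · have : IsEmpty {H : ℌ₁ // par H = F} := ⟨fun H => H.1.2.2 (by rw [huw H.1 H.2, huF])⟩
    simp only [Function.comp_apply, huF, map_zero, AddMonoidHom.zero_apply]
    exact hasSum_empty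
  · have h1 := hμ.hasSum_map (L := L) hL (u F) (h𝔉.sub F.2)
      (hℌ.sep (B := (F : Set X)) (fun H => w H ≠ 0 ∧ H ⊆ F) fun x => ⟨fun hx => ?_, ?_⟩)
    · rw [← hasSum_subtype_iff_indicator] at h1
      let e : {H : ℌ₁ // par H = F} ≃ {H ∈ ℌ | w H ≠ 0 ∧ H ⊆ F} :=
        { toFun := fun H => ⟨H.1, H.1.2.1, H.1.2.2, (hpar H.1).trans (congrArg Subtype.val H.2).subset⟩
          invFun := fun H => ⟨⟨H, H.2.1, H.2.2.1⟩, by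
            obtain ⟨x, hx⟩ := hℌ.nonempty _ H.2.1
            exact Subtype.ext (h𝔉.eq_of_mem _ (par _).2 _ F.2 x
              (hpar ⟨H, H.2.1, H.2.2.1⟩ hx) (H.2.2.2 hx))⟩
          left_inv := fun H => rfl
          right_inv := fun H => rfl }
      refine Eq.subst (motive := fun g => HasSum g (L (u F) (μ F))) ?_ (e.hasSum_iff.2 h1)
      ext H
      change L (u F) (μ H.1) = L (w H.1) (μ H.1)
      rw [huw H.1 H.2]
    · have hne : stepFun c E x ≠ 0 := by rwa [hu F F.2 x hx]
      have hxU : x ∈ ⋃₀ Set.range E := by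
        by_contra h; exact hne (stepFun_eq_zero h)
      obtain ⟨H, hH, hxH⟩ := (hℌ.mem_iff x).1 hxU
      have hwH : w H ≠ 0 := by rwa [← hw1 H hH x hxH]
      obtain ⟨F', hF', hHF'⟩ := hw2 H hH hwH
      obtain rfl := h𝔉.eq_of_mem _ hF' _ F.2 x (hHF' hxH) hx
      exact ⟨H, hH, ⟨hwH, hHF'⟩, hxH⟩
    · rintro ⟨H, _, ⟨_, h2⟩, hx⟩
      exact h2 hx

end Measure

end StepFunctions

theorem fibre_anti {X V : Type*} {𝒜 : Set (V × X)} {D E : Set X} (h : D ⊆ E) : fibre 𝒜 E ⊆ fibre 𝒜 D :=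
  fun _ hv x hx => hv x (h hx)

/-! ### From envelopes to gauges. -/

section EnvelopeToGauge

variable {X V W Z : Type*} [AddCommGroup V] [AddCommGroup W] [AddCommGroup Z]
variable {L : V →+ W →+ Z} {𝔖 : Set (Set X)} {μ : Set X → W} {f : X → V}

theorem mem_generated {𝔇 : Set (Set X)} {𝒜 : Set (V × X)} {v : V} {x : X} :
    (v, x) ∈ generated 𝔇 𝒜 ↔ (∃ D ∈ 𝔇, v ∈ fibre 𝒜 D ∧ x ∈ D) ∨ (v = 0 ∧ ∀ D ∈ 𝔇, x ∉ D) := by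
  simp only [generated, Set.mem_union, Set.mem_iUnion, Set.mem_prod, Set.mem_singleton_iff,
    Set.mem_compl_iff, Set.mem_sUnion, exists_prop, not_exists, not_and]

theorem exists_monotone_exhaustion {α : Type*} {s : Set α} (hs : s.Countable) :
    ∃ δ : ℕ → Finset α, Monotone δ ∧ (∀ n, ↑(δ n) ⊆ s) ∧ ∀ a ∈ s, ∃ n, a ∈ δ n := by
  classical
  rcases s.eq_empty_or_nonempty with rfl | hne
  · exact ⟨fun _ => ∅, monotone_const, by simp, by simp⟩
  obtain ⟨e, rfl⟩ := hs.exists_eq_range hne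
  refine ⟨fun n => (Finset.range (n + 1)).image e, fun m n h => Finset.image_subset_image
    (Finset.range_mono (by omega)), fun n a => ?_, ?_⟩
  · simp only [Finset.coe_image, Set.mem_image]
    rintro ⟨i, _, rfl⟩
    exact ⟨i, rfl⟩
  · rintro _ ⟨n, rfl⟩
    exact ⟨n, Finset.mem_image_of_mem _ (by simp)⟩

theorem Dec.union (h𝔖 : IsIntervalSystem 𝔖) {A B : Set X} (hA : Dec 𝔖 A) (hB : Dec 𝔖 B) :
    Dec 𝔖 (A ∪ B) := by
  obtain ⟨𝔈, h1, _⟩ := hA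
  obtain ⟨𝔉, h2, _⟩ := hB
  have := hasPartition_sUnion h𝔖 (h1.countable.union h2.countable) (Set.union_subset h1.sub h2.sub)
  rw [Set.sUnion_union, h1.sUnion_eq, h2.sUnion_eq] at this
  exact this.dec

/-- Every finite subfamily can be enlarged to one with a bad sum; interleaving this with an
exhaustion of `𝔈` makes the bad families increase to all of `𝔈`. -/
theorem not_evIn_exists_seq {𝔈 : Set (Set X)} (hc : 𝔈.Countable) {g : Set X → Z} {T : Set Z}
    (h : ¬ EvIn 𝔈 g T) : ∃ Ω : ℕ → Finset (Set X), Monotone Ω ∧ (∀ n, ↑(Ω n) ⊆ 𝔈) ∧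
      (∀ E ∈ 𝔈, ∃ n, E ∈ Ω n) ∧ ∀ n, ∑ E ∈ Ω n, g E ∉ T := by
  classical
  obtain ⟨δ, h1, h2, h3⟩ := exists_monotone_exhaustion hc
  have h4 : ∀ Ξ : Finset (Set X), ↑Ξ ⊆ 𝔈 → ∃ Ω : Finset (Set X), Ξ ⊆ Ω ∧ ↑Ω ⊆ 𝔈 ∧
      ∑ E ∈ Ω, g E ∉ T := by
    intro Ξ hΞ
    by_contra hcon
    push Not at hcon
    exact h ⟨Ξ, hΞ, hcon⟩
  choose! pick hp1 hp2 hp3 using h4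
  obtain ⟨Ω, hzero, hsucc⟩ : ∃ Ω : ℕ → Finset (Set X), Ω 0 = pick (δ 0) ∧
      ∀ n, Ω (n + 1) = pick (Ω n ∪ δ (n + 1)) :=
    ⟨fun n => Nat.rec (pick (δ 0)) (fun i R => pick (R ∪ δ (i + 1))) n, rfl, fun _ => rfl⟩
  have hsub : ∀ n, ((Ω n : Finset (Set X)) : Set (Set X)) ⊆ 𝔈 := by
    intro n
    induction n with
    | zero => rw [hzero]; exact hp2 _ (h2 0)
    | succ n ih =>
      rw [hsucc]
      exact hp2 _ (by rw [Finset.coe_union]; exact Set.union_subset ih (h2 _))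
  have hsub' : ∀ n, ((Ω n ∪ δ (n + 1) : Finset (Set X)) : Set (Set X)) ⊆ 𝔈 := fun n => by
    rw [Finset.coe_union]; exact Set.union_subset (hsub n) (h2 _)
  refine ⟨Ω, monotone_nat_of_le_succ fun n => ?_, hsub, fun E hE => ?_, fun n => ?_⟩
  · rw [hsucc]
    exact Finset.subset_union_left.trans (hp1 _ (hsub' n))
  · obtain ⟨n, hn⟩ := h3 E hE
    refine ⟨n + 1, ?_⟩
    rw [hsucc]
    exact hp1 _ (hsub' n) (Finset.mem_union_right _ (h1 (Nat.le_succ n) hn))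
  · cases n with
    | zero => rw [hzero]; exact hp3 _ (h2 0)
    | succ n => rw [hsucc]; exact hp3 _ (hsub' n)

variable [TopologicalSpace W] [UniformSpace Z] [IsUniformAddGroup Z] [CompleteSpace Z] [T2Space Z]

/-- If the Riemann sums of a subordinate division were not eventually in `T'`, there would be bad
finite families `Ω i` exhausting it. Let `A i` be the union of `Ω i` and of finitely many sets where
the value `0` is allowed. Replacing the envelope's step function `s` on `A i` by the Riemann step
function of `Ω i` stays inside `ℬ`, so the Riemann sum plus the integral of `s` outside `A i` lies
in `T`. That last term is in `U` for large `i`, a contradiction. -/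
theorem exists_controls_of_envelope (h𝔖 : IsIntervalSystem 𝔖) (hμ : IsMeasureOn 𝔖 μ)
    (hL : ∀ v : V, Continuous (L v)) {B : Set X} (hB : Dec 𝔖 B) {ℬ : Set (V × X)}
    (hℬ : IsEnvelope 𝔖 ℬ) (hf : graph (B.indicator f) ⊆ ℬ) {T T' U : Set Z}
    (hT : preIntegral L 𝔖 μ ℬ ⊆ T) (hU : U ∈ 𝓝 (0 : Z)) (hTU : ∀ t ∈ T, ∀ u ∈ U, t - u ∈ T') :
    ∃ r, Controls L 𝔖 μ f B T' r := by
  classical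
  obtain ⟨⟨n, c, E, hE, hs⟩, 𝔇, h𝔇, hc𝔇, hgen⟩ := hℬ
  set s := stepFun c E with hs_def
  set C := B ∪ ⋃₀ Set.range E with hC_def
  have hC : Dec 𝔖 C := hB.union h𝔖 (hasPartition_sUnion h𝔖 (Set.finite_range E).countable
    (Set.range_subset_iff.2 hE)).dec
  obtain ⟨𝔎, h𝔎, hconst⟩ := hC.stepFun h𝔖 (fun _ _ _ h => h) c hE
  have hcov : ∀ x ∈ C, ∀ v, (v, x) ∈ ℬ → ∃ D ∈ 𝔇 ∪ 𝔎, x ∈ D ∧ v ∈ fibre ℬ D := by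
    intro x hx v hv
    rw [hgen, mem_generated] at hv
    rcases hv with ⟨D, hD, hvD, hxD⟩ | ⟨rfl, hx𝔇⟩
    · exact ⟨D, Or.inl hD, hxD, hvD⟩
    -- Off `⋃₀ 𝔇` the envelope allows only `0`, so `s` vanishes at `x` and hence on the whole cell
    -- `K`. The graph of `s` lies in `ℬ`, so `0` is allowed on all of `K`.
    · obtain ⟨K, hK, hxK⟩ := (h𝔎.mem_iff x).1 hx
      refine ⟨K, Or.inr hK, hxK, fun y hy => ?_⟩
      obtain ⟨-, u, hu⟩ := hconst K hK
      have h1 : (s x, x) ∈ ℬ := hs rfl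
      rw [hgen, mem_generated] at h1
      rcases h1 with ⟨D, hD, _, hxD⟩ | ⟨h1, _⟩
      · exact (hx𝔇 D hD hxD).elim
      · have : s y = 0 := by rw [hs_def, hu y hy, ← hu x hxK, ← hs_def, h1]
        exact hs this.symm
  have hsub : 𝔇 ∪ 𝔎 ⊆ 𝔖 := Set.union_subset h𝔇 h𝔎.sub
  have hcount : (𝔇 ∪ 𝔎).Countable := hc𝔇.union h𝔎.countable
  have hr : ∀ x ∈ B, ∃ D ∈ 𝔇 ∪ 𝔎, x ∈ D ∧ f x ∈ fibre ℬ D := fun x hx =>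
    hcov x (Or.inl hx) _ (hf (Set.indicator_of_mem hx f).symm)
  choose! r hr1 hr2 hr3 using hr
  refine ⟨r, ⟨fun x hx => hsub (hr1 x hx), hr2, hcount.mono (Set.image_subset_iff.2 hr1)⟩,
    fun 𝔈 v h𝔈 hv => ?_⟩
  have hvf : ∀ E ∈ 𝔈, v E ∈ fibre ℬ E := by
    intro E hE
    obtain ⟨x, hx, h1, h2⟩ := hv E hE
    rw [h2]
    exact fibre_anti h1 (hr3 x hx)
  by_contra hev
  obtain ⟨Ω, hΩm, hΩ𝔈, hΩex, hΩT⟩ := not_evIn_exists_seq h𝔈.countable hev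
  obtain ⟨Δ, hΔm, hΔ, hΔex⟩ := exists_monotone_exhaustion
    (s := {D ∈ 𝔇 ∪ 𝔎 | (0 : V) ∈ fibre ℬ D}) (hcount.mono fun _ h => h.1)
  have hΓ𝔖 : ∀ i, ((Ω i ∪ Δ i : Finset (Set X)) : Set (Set X)) ⊆ 𝔖 := by
    intro i
    rw [Finset.coe_union]
    exact Set.union_subset ((hΩ𝔈 i).trans h𝔈.sub) ((hΔ i).trans fun D hD => hsub hD.1)
  set A : ℕ → Set X := fun i => ⋃₀ ((Ω i ∪ Δ i : Finset (Set X)) : Set (Set X)) with hA_def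
  have hAm : Monotone A := fun i j hij => Set.sUnion_subset_sUnion
    (Finset.coe_subset.2 (Finset.union_subset_union (hΩm hij) (hΔm hij)))
  have hAs : ∀ k, disjointed A (k + 1) = A (k + 1) \ A k := fun k =>
    hAm.disjointed_succ (not_isMax k)
  have hAp : ∀ i, HasPartition 𝔖 (fun F => ∃ G ∈ (Ω i ∪ Δ i : Finset (Set X)), F ⊆ G) (A i) :=
    fun i => hasPartition_sUnion h𝔖 (Finset.countable_toSet _) (hΓ𝔖 i)
  have hCA : C ⊆ ⋃ i, A i := by
    intro x hx
    rw [Set.mem_iUnion]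
    by_cases hxB : x ∈ B
    · obtain ⟨E, hE, hxE⟩ := (h𝔈.mem_iff x).1 hxB
      obtain ⟨i, hi⟩ := hΩex E hE
      exact ⟨i, E, by simp [hi], hxE⟩
    · obtain ⟨D, hD, hxD, h0⟩ := hcov x hx 0 (hf (Set.indicator_of_notMem hxB f).symm)
      obtain ⟨i, hi⟩ := hΔex D ⟨hD, h0⟩
      exact ⟨i, D, by simp [hi], hxD⟩
  have hs0 : ∀ x ∉ ⋃ i, A i, stepFun c E x = 0 := fun x hx =>
    stepFun_eq_zero fun h => hx (hCA (Or.inr h))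
  let val : Set X → V := fun F => if h : F.Nonempty then s h.some else 0
  have hval : ∀ F : Set X, (∃ u, ∀ x ∈ F, stepFun c E x = u) → ∀ x ∈ F, stepFun c E x = val F := by
    rintro F ⟨u, hu⟩ x hx
    have hne : F.Nonempty := ⟨x, hx⟩
    simp only [val, dif_pos hne]
    rw [hu x hx, hs_def, hu _ hne.some_mem]
  -- The partition is compatible with all `A i` at once. The complement of each `A i` is then
  -- covered by a subfamily of the same `𝔉`, and a single finite set `Ξ` bounds all the tails.
  have h𝔉 : HasPartition 𝔖 (fun F => (∀ i, F ⊆ A i ∨ Disjoint F (A i)) ∧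
      ∃ u, ∀ x ∈ F, stepFun c E x = u) (⋃ i, A i) := by
    rw [← iUnion_disjointed]
    refine HasPartition.iUnion (fun i j x hi hj => ?_) fun k => ?_
    · by_contra hij
      exact Set.disjoint_left.1 (disjoint_disjointed A hij) hi hj
    · have hd : Dec 𝔖 (disjointed A k) := by
        cases k with
        | zero => rw [disjointed_zero]; exact (hAp 0).dec
        | succ k =>
          rw [hAs]
          exact dec_diff_sUnion h𝔖 (hAp (k + 1)).dec (Finset.finite_toSet _) (hΓ𝔖 k)
      refine (hd.stepFun h𝔖 (fun _ _ _ h => h) c hE).mono fun F _ hF _ h => ⟨fun i => ?_, h.2⟩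
      rcases le_or_gt k i with hki | hki
      · exact Or.inl ((hF.trans (disjointed_subset A k)).trans (hAm hki))
      · refine Or.inr (Disjoint.mono_left hF ?_)
        obtain ⟨k, rfl⟩ : ∃ m, k = m + 1 := ⟨k - 1, by omega⟩
        rw [hAs]
        exact Set.disjoint_sdiff_left.mono_right (hAm (by omega))
  obtain ⟨𝔉, h𝔉, h𝔉p⟩ := h𝔉
  have hsum := hasSum_stepFun h𝔖 hμ hL hE h𝔉 (fun F hF => hval F (h𝔉p F hF).2) hs0
  -- Completeness of `Z` makes subfamilies summable. The index `i` is then taken so large that every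
  -- cell in `Ξ` meets `A i`.
  obtain ⟨Ξ, hΞ⟩ := hsum.summable.tsum_vanishing hU
  have hN : ∀ F ∈ Ξ, ∃ N, F ∈ 𝔉 → ∀ i ≥ N, ¬ Disjoint F (A i) := by
    intro F _
    by_cases hF : F ∈ 𝔉
    · obtain ⟨x, hx⟩ := h𝔉.nonempty F hF
      obtain ⟨N, hN⟩ := Set.mem_iUnion.1 (h𝔉.subset hF hx)
      exact ⟨N, fun _ i hi hd => Set.disjoint_left.1 hd hx (hAm hi hN)⟩
    · exact ⟨0, fun h => (hF h).elim⟩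
  choose! N hN using hN
  obtain ⟨i, hi⟩ : ∃ i, ∀ F ∈ Ξ, N F ≤ i := ⟨Ξ.sup N, fun F hF => Finset.le_sup hF⟩
  set ℜ : Set (Set X) := {F ∈ 𝔉 | Disjoint F (A i)} with hℜ_def
  have hℜΞ : Disjoint ℜ ↑Ξ := Set.disjoint_left.2 fun F hF hFΞ =>
    hN F hFΞ hF.1 i (hi F hFΞ) hF.2
  have hρ := hΞ ℜ hℜΞ
  set ρ := ∑' b : ℜ, 𝔉.indicator (fun F => L (val F) (μ F)) b with hρ_def
  have hρsum : HasSum (ℜ.indicator fun F => L (val F) (μ F)) ρ := by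
    have h1 : HasSum ((𝔉.indicator fun F => L (val F) (μ F)) ∘ ((↑) : ℜ → Set X)) ρ :=
      (hsum.summable.subtype ℜ).hasSum
    rw [hasSum_subtype_iff_indicator, Set.indicator_indicator,
      Set.inter_eq_left.2 fun F hF => hF.1] at h1
    exact h1
  have hℜ : IsPartition 𝔖 ((⋃ i, A i) \ A i) ℜ := by
    refine h𝔉.sep _ fun x => ⟨fun hx => ?_, ?_⟩
    · obtain ⟨F, hF, hxF⟩ := (h𝔉.mem_iff x).1 hx.1
      exact ⟨F, hF, ((h𝔉p F hF).1 i).resolve_left fun h => hx.2 (h hxF), hxF⟩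
    · rintro ⟨F, hF, hd, hx⟩
      exact ⟨h𝔉.subset hF hx, Set.disjoint_left.1 hd hx⟩
  have hΩ𝔖 : ((Ω i : Finset (Set X)) : Set (Set X)) ⊆ 𝔖 := (hΩ𝔈 i).trans h𝔈.sub
  have h𝔊 : HasPartition 𝔖 (fun G => ∃ w, (∃ u, ∀ x ∈ G, stepFun c E x = u) ∧ w ∈ fibre ℬ G ∧
      ∀ x ∈ G, ∑ F ∈ Ω i, F.indicator (fun _ => v F) x = w) (A i) := by
    refine (((hAp i).split h𝔖 (fun E F h ⟨G, hG, hEG⟩ => ⟨G, hG, h.trans hEG⟩)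
      (Finset.finite_toSet (Ω i)) hΩ𝔖).stepFun h𝔖 (fun E F h ⟨⟨G, hG, hEG⟩, h2⟩ =>
        ⟨⟨G, hG, h.trans hEG⟩, fun D hD => (h2 D hD).imp h.trans fun h3 => h3.mono_left h⟩)
      c hE).mono ?_
    rintro G - - ⟨y, hy⟩ ⟨⟨⟨D, hD, hGD⟩, hcomp⟩, hu⟩
    by_cases hex : ∃ F ∈ Ω i, G ⊆ F
    · obtain ⟨F, hF, hGF⟩ := hex
      refine ⟨v F, hu, fibre_anti hGF (hvf F (hΩ𝔈 i hF)), fun x hx => ?_⟩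
      exact sum_indicator_of_mem hF (hGF hx) fun F' hF' hx' =>
        h𝔈.eq_of_mem _ (hΩ𝔈 i hF') _ (hΩ𝔈 i hF) x hx' (hGF hx)
    -- A cell of `A i` contained in no member of `Ω i` lies in one of the sets where `0` is allowed,
    -- and there the Riemann step function is `0`.
    · push Not at hex
      refine ⟨0, hu, ?_, fun x hx => sum_indicator_of_notMem fun F hF =>
        Set.disjoint_left.1 ((hcomp F hF).resolve_left (hex F hF)) hx⟩
      rcases Finset.mem_union.1 hD with hD | hD
      · exact (hex D hD hGD).elim
      · exact fibre_anti hGD (hΔ i hD).2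
  obtain ⟨𝔊, w, h𝔊, hw⟩ := h𝔊.exists_val
  have hAi : A i ∪ ((⋃ i, A i) \ A i) = ⋃ i, A i :=
    Set.union_sdiff_cancel (Set.subset_iUnion A i)
  have hunion := h𝔊.union hℜ Set.disjoint_sdiff_right
  rw [hAi] at hunion
  have hsum2 := hasSum_stepFun (L := L) (u := val) h𝔖 hμ hL hE hunion (fun F hF => hF.elim
    (fun hF => hval F (hw F hF).1) fun hF => hval F (h𝔉p F hF.1).2) hs0
  have hdisj : Disjoint 𝔊 ℜ := Set.disjoint_left.2 fun G hG hGℜ => by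
    obtain ⟨x, hx⟩ := h𝔊.nonempty G hG
    exact Set.disjoint_left.1 hGℜ.2 hx (h𝔊.subset hG hx)
  rw [Set.indicator_union_of_disjoint hdisj] at hsum2
  have hsum3 : HasSum (𝔊.indicator fun F => L (val F) (μ F))
      (∑ j, L (c j) (μ (E j)) - ρ) := by
    simpa using hsum2.sub hρsum
  obtain ⟨m, d, G, hG, h1, h2⟩ := exists_stepFun_eq (L := L) (μ := μ) (𝔖 := 𝔖) (Ω i) v hΩ𝔖
  have hsum4 := hasSum_stepFun (L := L) (u := w) h𝔖 hμ hL hG h𝔊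
    (fun F hF x hx => by rw [h1]; exact (hw F hF).2.2 x hx) (fun x hx => by
      rw [h1]
      exact sum_indicator_of_notMem fun F hF hxF => hx ⟨F, by simp [Finset.mem_coe.1 hF], hxF⟩)
  rw [h2] at hsum4
  -- The sum of `s` over `A i` is its total minus the tail `ρ`. The exchange on `A i` thus yields
  -- the element Riemann sum plus `ρ` of the bilinear sum.
  have hmem := add_mem_preIntegral (L := L) (μ := μ) hE hs h𝔊
    (fun F hF => hval F (hw F hF).1) (fun F hF => (hw F hF).2.1)
    (z := ∑ F ∈ Ω i, L (v F) (μ F) - (∑ j, L (c j) (μ (E j)) - ρ)) (by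
      convert hsum4.sub hsum3 using 1
      ext F
      by_cases hF : F ∈ 𝔊 <;> simp [hF])
  refine hΩT i ?_
  convert hTU _ (hT hmem) ρ hρ using 1
  abel

end EnvelopeToGauge

/-! ### Small tails of Riemann sums, and from gauges to envelopes. -/

section GaugeToEnvelope

variable {X V W Z : Type*} [AddCommGroup V] [AddCommGroup W] [AddCommGroup Z]
variable {L : V →+ W →+ Z} {𝔖 : Set (Set X)} {μ : Set X → W} {f : X → V}

open scoped Pointwise

/-- The threshold `Ξ` meets only finitely many of the disjoint `Φ n`. Adding another `Φ n` to `Ξ`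
keeps the sum in `T`, so the sum over `Φ n` is a difference of two elements of `T`. -/
theorem EvIn.exists_sub_mem {𝔈 : Set (Set X)} {g : Set X → Z} {T : Set Z} (h : EvIn 𝔈 g T)
    {Φ : ℕ → Finset (Set X)} (hΦ : ∀ n, ↑(Φ n) ⊆ 𝔈) (hd : ∀ m n, m < n → Disjoint (Φ m) (Φ n)) :
    ∃ n, ∑ E ∈ Φ n, g E ∈ T - T := by
  classical
  obtain ⟨Ξ, h1, h2⟩ := h
  obtain ⟨n, hn⟩ : ∃ n, Disjoint (Φ n) Ξ := by
    by_contra hcon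
    push Not at hcon
    have h3 : ∀ n, ∃ E, E ∈ Φ n ∧ E ∈ Ξ := fun n => Finset.not_disjoint_iff.1 (hcon n)
    choose e he1 he2 using h3
    have hinj : Function.Injective fun n => (⟨e n, he2 n⟩ : Ξ) := by
      intro m n hmn
      have hmn : e m = e n := congrArg Subtype.val hmn
      rcases lt_trichotomy m n with h | h | h
      · exact (Finset.disjoint_left.1 (hd m n h) (he1 m) (hmn ▸ he1 n)).elim
      · exact h
      · exact (Finset.disjoint_left.1 (hd n m h) (he1 n) (hmn ▸ he1 m)).elim
    exact not_injective_infinite_finite _ hinj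
  refine ⟨n, Set.mem_sub.2 ⟨_, h2 (Φ n ∪ Ξ) Finset.subset_union_right ?_, _, h2 Ξ subset_rfl h1, ?_⟩⟩
  · rw [Finset.coe_union]
    exact Set.union_subset (hΦ n) h1
  · rw [Finset.sum_union hn, add_sub_cancel_right]

/-- Riemann sums over finite families inside all but finitely many members of a partition are
small. -/
theorem Controls.exists_finset_tail (h𝔖 : IsIntervalSystem 𝔖) {A : Set X} {T : Set Z}
    {r : X → Set X} (h : Controls L 𝔖 μ f A T r) {𝔈 : Set (Set X)} (h𝔈 : IsPartition 𝔖 A 𝔈) :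
    ∃ Ξ : Finset (Set X), ↑Ξ ⊆ 𝔈 ∧ ∀ (Φ : Finset (Set X)) (v : Set X → V), ↑Φ ⊆ 𝔖 →
      (∀ F ∈ Φ, F.Nonempty) → (∀ F ∈ Φ, ∀ G ∈ Φ, ∀ x, x ∈ F → x ∈ G → F = G) →
      (∀ F ∈ Φ, ∃ E ∈ 𝔈, E ∉ Ξ ∧ F ⊆ E) → (∀ F ∈ Φ, Adm f A r F (v F)) →
      ∑ F ∈ Φ, L (v F) (μ F) ∈ T - T := by
  classical
  by_contra hcon
  push Not at hcon
  let P : Finset (Set X) × (Set X → V) → Prop := fun p => ↑p.1 ⊆ 𝔖 ∧ (∀ F ∈ p.1, F.Nonempty) ∧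
    (∀ F ∈ p.1, ∀ G ∈ p.1, ∀ x, x ∈ F → x ∈ G → F = G) ∧ (∀ F ∈ p.1, ∃ E ∈ 𝔈, F ⊆ E) ∧
    (∀ F ∈ p.1, Adm f A r F (p.2 F)) ∧ ∑ F ∈ p.1, L (p.2 F) (μ F) ∉ T - T
  -- If no finite `Ξ` works, bad families can be chosen successively, each inside cells of `𝔈` not
  -- used by the earlier ones. Completing their union to one subordinate division of `A` contradicts
  -- `EvIn.exists_sub_mem`.
  obtain ⟨p, hp, hpr⟩ := exists_seq_of_forall_finset_exists P
    (fun p q => ∀ F ∈ p.1, ∀ G ∈ q.1, ∀ E ∈ 𝔈, F ⊆ E → ¬ G ⊆ E) (by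
      intro s hs
      have hpar : ∀ F, (∃ E ∈ 𝔈, F ⊆ E) → ∃ E ∈ 𝔈, F ⊆ E := fun F h => h
      choose! par hpar1 hpar2 using hpar
      -- The excluded cells are the parents of all sets occurring in the earlier families.
      obtain ⟨Φ, v, h1, h2, h3, h4, h5, h6⟩ := hcon ((s.biUnion Prod.fst).image par) (by
        intro E hE
        simp only [Finset.coe_image, Set.mem_image, Finset.mem_coe, Finset.mem_biUnion] at hE
        obtain ⟨F, ⟨p, hp, hF⟩, rfl⟩ := hE
        exact hpar1 F ((hs p hp).2.2.2.1 F hF))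
      refine ⟨(Φ, v), ⟨h1, h2, h3, fun F hF => ?_, h5, h6⟩, fun p hp F hF G hG E hE hFE hGE => ?_⟩
      · obtain ⟨E, hE, _, hFE⟩ := h4 F hF
        exact ⟨E, hE, hFE⟩
      · obtain ⟨E', hE', hne, hGE'⟩ := h4 G hG
        obtain ⟨x, hx⟩ := h2 G hG
        obtain rfl := h𝔈.eq_of_mem _ hE _ hE' x (hGE hx) (hGE' hx)
        have hex := (hs p hp).2.2.2.1 F hF
        obtain ⟨y, hy⟩ := (hs p hp).2.1 F hF
        have := h𝔈.eq_of_mem _ hE _ (hpar1 F hex) y (hFE hy) (hpar2 F hex hy)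
        exact hne (this ▸ Finset.mem_image_of_mem _ (Finset.mem_biUnion.2 ⟨p, hp, hF⟩)))
  choose hP1 hP2 hP3 hP4 hP5 hP6 using hp
  have hne : ∀ m n, m ≠ n → ∀ F ∈ (p m).1, ∀ G ∈ (p n).1, ∀ E ∈ 𝔈, F ⊆ E → ¬ G ⊆ E := by
    intro m n hmn F hF G hG E hE hFE hGE
    rcases lt_or_gt_of_ne hmn with h | h
    · exact hpr m n h F hF G hG E hE hFE hGE
    · exact hpr n m h G hG F hF E hE hGE hFE
  have huniq : ∀ m n F, F ∈ (p m).1 → F ∈ (p n).1 → m = n := by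
    intro m n F hm hn
    by_contra hmn
    obtain ⟨E, hE, hFE⟩ := hP4 m F hm
    exact hne m n hmn F hm F hn E hE hFE hFE
  set 𝔊 : Set (Set X) := ⋃ n, ((p n).1 : Set (Set X)) with h𝔊_def
  have hmem𝔊 : ∀ F, F ∈ 𝔊 ↔ ∃ n, F ∈ (p n).1 := fun F => by simp [𝔊]
  have h𝔊A : ⋃₀ 𝔊 ⊆ A := by
    rintro x ⟨F, hF, hx⟩
    obtain ⟨n, hn⟩ := (hmem𝔊 F).1 hF
    obtain ⟨E, hE, hFE⟩ := hP4 n F hn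
    exact h𝔈.subset hE (hFE hx)
  have h𝔊 : IsPartition 𝔖 (⋃₀ 𝔊) 𝔊 := by
    refine ⟨Set.iUnion_subset hP1, Set.countable_iUnion fun n => Finset.countable_toSet _,
      fun F hF => ?_, fun F hF G hG x hx hx' => ?_, fun x => Iff.rfl⟩
    · obtain ⟨n, hn⟩ := (hmem𝔊 F).1 hF
      exact hP2 n F hn
    · obtain ⟨m, hm⟩ := (hmem𝔊 F).1 hF
      obtain ⟨n, hn⟩ := (hmem𝔊 G).1 hG
      have hmn : m = n := by
        by_contra hmn
        obtain ⟨E, hE, hFE⟩ := hP4 m F hm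
        obtain ⟨E', hE', hGE⟩ := hP4 n G hn
        obtain rfl := h𝔈.eq_of_mem _ hE _ hE' x (hFE hx) (hGE hx')
        exact hne m n hmn F hm G hn E hE hFE hGE
      subst hmn
      exact hP3 m F hm G hn x hx hx'
  -- Infinitely many sets are removed from `A`, but each cell of `𝔈` meets only one of the families
  -- `(p n).1`, hence loses only finitely many of them.
  have hrest : Dec 𝔖 (A \ ⋃₀ 𝔊) := by
    have h1 : HasPartition 𝔖 (fun _ => True) ((⋃₀ 𝔊)ᶜ ∩ A) := by
      refine HasPartition.inter_bind ⟨𝔈, h𝔈, fun E hE => hE⟩ fun E hE𝔖 _ _ hE => ?_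
      have h2 : (⋃₀ 𝔊)ᶜ ∩ E = E \ ⋃₀ {F ∈ 𝔊 | F ⊆ E} := by
        ext x
        constructor
        · rintro ⟨h3, h4⟩
          exact ⟨h4, fun ⟨F, hF, hx⟩ => h3 ⟨F, hF.1, hx⟩⟩
        · rintro ⟨h3, h4⟩
          refine ⟨fun ⟨F, hF, hx⟩ => h4 ⟨F, ⟨hF, ?_⟩, hx⟩, h3⟩
          obtain ⟨n, hn⟩ := (hmem𝔊 F).1 hF
          obtain ⟨E', hE', hFE⟩ := hP4 n F hn
          obtain rfl := h𝔈.eq_of_mem _ hE _ hE' x h3 (hFE hx)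
          exact hFE
      rw [h2]
      refine dec_diff_sUnion h𝔖 (hasPartition_self hE𝔖 trivial) ?_ fun F hF => h𝔊.sub hF.1
      rcases Set.eq_empty_or_nonempty {F ∈ 𝔊 | F ⊆ E} with h3 | ⟨F, hF, hFE⟩
      · rw [h3]; exact Set.finite_empty
      · obtain ⟨n, hn⟩ := (hmem𝔊 F).1 hF
        refine (Finset.finite_toSet (p n).1).subset fun G ⟨hG, hGE⟩ => ?_
        obtain ⟨m, hm⟩ := (hmem𝔊 G).1 hG
        by_cases hmn : m = n
        · exact hmn ▸ hm
        · exact (hne m n hmn G hm F hn E hE hGE hFE).elim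
    rwa [Set.inter_comm, ← Set.sdiff_eq] at h1
  obtain ⟨ℜ, w, hℜ, hw⟩ := (((h.isGauge.mono Set.sdiff_subset).hasPartition h𝔖 hrest).mono
    (q := fun E => ∃ v, Adm f A r E v)
    (by rintro E _ _ _ ⟨x, hx, hE⟩; exact ⟨f x, x, hx.1, hE, rfl⟩)).exists_val
  let v : Set X → V := fun F => if h : ∃ n, F ∈ (p n).1 then (p h.choose).2 F else w F
  have hv : ∀ n, ∀ F ∈ (p n).1, v F = (p n).2 F := by
    intro n F hF
    have hex : ∃ n, F ∈ (p n).1 := ⟨n, hF⟩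
    simp only [v, dif_pos hex]
    rw [huniq _ _ F hex.choose_spec hF]
  have hev := h.evIn (𝔊 ∪ ℜ) v (by
    have := h𝔊.union hℜ Set.disjoint_sdiff_right
    rwa [Set.union_sdiff_cancel h𝔊A] at this) (by
    intro F hF
    by_cases hex : ∃ n, F ∈ (p n).1
    · obtain ⟨n, hn⟩ := hex
      rw [hv n F hn]
      exact hP5 n F hn
    · have h1 : v F = w F := by simp only [v, dif_neg hex]
      rw [h1]
      exact hw F (hF.resolve_left fun h => hex ((hmem𝔊 F).1 h)))
  obtain ⟨n, hn⟩ := hev.exists_sub_mem (Φ := fun n => (p n).1)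
    (fun n => (Set.subset_iUnion (fun n => ((p n).1 : Set (Set X))) n).trans
      Set.subset_union_left)
    (fun m n hmn => Finset.disjoint_left.2 fun F hm hn => hmn.ne (huniq m n F hm hn))
  refine hP6 n ?_
  rwa [Finset.sum_congr rfl fun F hF => by rw [hv n F hF]] at hn

variable [TopologicalSpace W] [TopologicalSpace Z] [IsTopologicalAddGroup Z] [T2Space Z]

/-- The envelope allows `f x` on `r x`, and also `0` off `B` and on the cells of `𝔈` outside the
finite set `Ξ`. Without the latter, no step function over finitely many sets need fit. A step
function inside it agrees with a subordinate Riemann assignment, except where it is `0` on cells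
outside `Ξ`. There the Riemann terms are subtracted, and their sum lies in `T - T`. -/
theorem Controls.exists_envelope (h𝔖 : IsIntervalSystem 𝔖) (hμ : IsMeasureOn 𝔖 μ)
    (hL : ∀ v : V, Continuous (L v)) {B : Set X} (hB : Dec 𝔖 B) {T : Set Z} {r : X → Set X}
    (hr : Controls L 𝔖 μ f B T r) :
    ∃ ℬ : Set (V × X), IsEnvelope 𝔖 ℬ ∧ graph (B.indicator f) ⊆ ℬ ∧
      preIntegral L 𝔖 μ ℬ ⊆ closure (T - (T - T)) := by
  classical
  obtain ⟨r, hr, hrB⟩ := hr.exists_subset h𝔖 hB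
  obtain ⟨𝔈, v₀, h𝔈, hv₀⟩ := ((hr.isGauge.hasPartition h𝔖 hB).mono
    (q := fun E => ∃ v, Adm f B r E v)
    (by rintro E _ _ _ ⟨x, hx, hE⟩; exact ⟨f x, x, hx, hE, rfl⟩)).exists_val
  obtain ⟨Ξ, hΞ𝔈, hΞ⟩ := hr.exists_finset_tail h𝔖 h𝔈
  set ℬ : Set (V × X) := {p | (∃ x ∈ B, p.1 = f x ∧ p.2 ∈ r x) ∨
    (p.1 = 0 ∧ ∃ E ∈ 𝔈, E ∉ Ξ ∧ p.2 ∈ E) ∨ (p.1 = 0 ∧ p.2 ∉ B)} with hℬ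
  have hmem : ∀ v x, (v, x) ∈ ℬ ↔ (∃ y ∈ B, v = f y ∧ x ∈ r y) ∨
    (v = 0 ∧ ∃ E ∈ 𝔈, E ∉ Ξ ∧ x ∈ E) ∨ (v = 0 ∧ x ∉ B) := fun v x => Iff.rfl
  refine ⟨ℬ, ⟨?_, r '' B ∪ {E ∈ 𝔈 | E ∉ Ξ}, Set.union_subset
    (Set.image_subset_iff.2 hr.isGauge.mem) fun E hE => h𝔈.sub hE.1,
    hr.isGauge.countable.union (h𝔈.countable.mono fun E hE => hE.1), ?_⟩, ?_, ?_⟩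
  · obtain ⟨n, c, E, hE, h1, -⟩ := exists_stepFun_eq (L := L) (μ := μ) Ξ v₀ (hΞ𝔈.trans h𝔈.sub)
    refine ⟨n, c, E, hE, ?_⟩
    rintro ⟨y, x⟩ hy
    have hy : y = _ := hy
    rw [h1] at hy
    rw [hmem]
    by_cases hx : x ∈ B
    · obtain ⟨F, hF, hxF⟩ := (h𝔈.mem_iff x).1 hx
      by_cases hFΞ : F ∈ Ξ
      · obtain ⟨z, hz, hFz, hvz⟩ := hv₀ F hF
        refine Or.inl ⟨z, hz, ?_, hFz hxF⟩
        rw [hy, ← hvz]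
        exact sum_indicator_of_mem hFΞ hxF fun G hG hxG =>
          h𝔈.eq_of_mem _ (hΞ𝔈 hG) _ hF x hxG hxF
      · refine Or.inr (Or.inl ⟨?_, F, hF, hFΞ, hxF⟩)
        rw [hy]
        exact sum_indicator_of_notMem fun G hG hxG =>
          hFΞ (h𝔈.eq_of_mem _ (hΞ𝔈 hG) _ hF x hxG hxF ▸ hG)
    · refine Or.inr (Or.inr ⟨?_, hx⟩)
      rw [hy]
      exact sum_indicator_of_notMem fun G hG hxG => hx (h𝔈.subset (hΞ𝔈 hG) hxG)
  · ext ⟨v, x⟩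
    rw [mem_generated]
    constructor
    · rw [hmem]
      rintro (⟨y, hy, rfl, hx⟩ | ⟨rfl, E, hE, hEΞ, hx⟩ | ⟨rfl, hx⟩)
      · exact Or.inl ⟨r y, Or.inl ⟨y, hy, rfl⟩, fun z hz => Or.inl ⟨y, hy, rfl, hz⟩, hx⟩
      · exact Or.inl ⟨E, Or.inr ⟨hE, hEΞ⟩,
          fun z hz => Or.inr (Or.inl ⟨rfl, E, hE, hEΞ, hz⟩), hx⟩
      · refine Or.inr ⟨rfl, ?_⟩
        rintro D (⟨y, hy, rfl⟩ | hD) hxD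
        · exact hx (hrB y hy hxD).2
        · exact hx (h𝔈.subset hD.1 hxD)
    · rintro (⟨D, _, hv, hx⟩ | ⟨rfl, hx⟩)
      · exact hv x hx
      · exact Or.inr (Or.inr ⟨rfl, fun hxB =>
          hx _ (Or.inl ⟨x, hxB, rfl⟩) (hr.isGauge.self_mem x hxB)⟩)
  · rintro ⟨y, x⟩ hy
    have hy : y = B.indicator f x := hy
    rw [hmem]
    by_cases hx : x ∈ B
    · rw [Set.indicator_of_mem hx] at hy
      exact Or.inl ⟨x, hx, hy, hr.isGauge.self_mem x hx⟩
    · rw [Set.indicator_of_notMem hx] at hy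
      exact Or.inr (Or.inr ⟨hy, hx⟩)
  refine closure_minimal ?_ isClosed_closure
  rintro z ⟨n, c, E, hE, hg, rfl⟩
  -- The first component is the value of the step function, the second an admissible Riemann value.
  -- They may differ only where the former is `0` on a cell outside `Ξ`.
  have h𝔊 : HasPartition 𝔖 (fun G => ∃ uw : V × V, (∀ x ∈ G, stepFun c E x = uw.1) ∧
      Adm f B r G uw.2 ∧ (uw.2 ≠ uw.1 → uw.1 = 0 ∧ ∃ E ∈ 𝔈, E ∉ Ξ ∧ G ⊆ E)) B := by
    refine (HasPartition.stepFun h𝔖 (p := fun G => ∃ E ∈ 𝔈, G ⊆ E)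
      (fun G F hFG ⟨E, hE, hGE⟩ => ⟨E, hE, hFG.trans hGE⟩)
      ⟨𝔈, h𝔈, fun E hE => ⟨E, hE, subset_rfl⟩⟩ c hE).bind ?_
    rintro F hF𝔖 - - ⟨⟨D, hD, hFD⟩, u, hu⟩
    by_cases h0 : u = 0 ∧ D ∉ Ξ
    · exact hasPartition_self hF𝔖 ⟨(u, v₀ D), hu, (hv₀ D hD).mono subset_rfl
        (fun _ _ => subset_rfl) hFD, fun _ => ⟨h0.1, D, hD, h0.2, hFD⟩⟩
    -- Here `u` cannot be one of the added zeros, so it is a value `f y` with `x ∈ r y`; refining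
    -- along these sets `r y` makes `u` itself admissible.
    · have hcov : ∀ x ∈ F, ∃ y ∈ B, u = f y ∧ x ∈ r y := by
        intro x hx
        have h1 : (u, x) ∈ ℬ := hg (hu x hx).symm
        rcases (hmem u x).1 h1 with h | ⟨h1, E', hE', hE'Ξ, hxE'⟩ | ⟨_, h2⟩
        · exact h
        · obtain rfl := h𝔈.eq_of_mem _ hD _ hE' x (hFD hx) hxE'
          exact (h0 ⟨h1, hE'Ξ⟩).elim
        · exact (h2 (h𝔈.subset hD (hFD hx))).elim
      refine (Dec.subordinate h𝔖 (hasPartition_self hF𝔖 trivial)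
        (𝔇 := r '' {y ∈ B | u = f y}) (hr.isGauge.countable.mono
          (Set.image_mono fun y hy => hy.1)) ?_ fun x hx => ?_).mono ?_
      · rintro _ ⟨y, hy, rfl⟩
        exact hr.isGauge.mem y hy.1
      · obtain ⟨y, hy, h1, h2⟩ := hcov x hx
        exact ⟨r y, ⟨y, ⟨hy, h1⟩, rfl⟩, h2⟩
      · rintro G - hGF - ⟨_, ⟨y, ⟨hy, h1⟩, rfl⟩, hG⟩
        exact ⟨(u, u), fun x hx => hu x (hGF hx), ⟨y, hy, hG, h1⟩, fun h => (h rfl).elim⟩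
  obtain ⟨𝔊, w, h𝔊, hw⟩ := h𝔊.exists_val
  have hsum := hasSum_stepFun (L := L) (u := fun G => (w G).1) h𝔖 hμ hL hE h𝔊
    (fun G hG => (hw G hG).1) (fun x hx => by
      have h1 : (stepFun c E x, x) ∈ ℬ := hg rfl
      rcases (hmem _ x).1 h1 with ⟨y, hy, _, h2⟩ | ⟨h1, _⟩ | ⟨h1, _⟩
      · exact (hx (hrB y hy h2).2).elim
      · exact h1
      · exact h1)
  obtain ⟨Ξ₁, hΞ₁, hev⟩ := hr.evIn 𝔊 (fun G => (w G).2) h𝔊 fun G hG => (hw G hG).2.1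
  refine mem_closure_of_tendsto hsum ?_
  refine (eventually_ge_atTop Ξ₁).mono fun Ω hΩ => ?_
  have hfil : ∑ G ∈ Ω, 𝔊.indicator (fun G => L (w G).1 (μ G)) G =
      ∑ G ∈ Ω with G ∈ 𝔊, L (w G).1 (μ G) := by
    rw [Finset.sum_filter]
    exact Finset.sum_congr rfl fun G _ => by simp [Set.indicator_apply]
  rw [hfil]
  set Ω' := Ω.filter (· ∈ 𝔊) with hΩ'
  have hΩ'𝔊 : ∀ G ∈ Ω', G ∈ 𝔊 := fun G hG => (Finset.mem_filter.1 hG).2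
  have h1 := hev Ω' (fun G hG => Finset.mem_filter.2 ⟨hΩ hG, hΞ₁ hG⟩) hΩ'𝔊
  set Φ := Ω'.filter (fun G => (w G).2 ≠ (w G).1) with hΦ
  have hΦ' : ∀ G ∈ Φ, G ∈ 𝔊 ∧ (w G).2 ≠ (w G).1 := fun G hG =>
    ⟨hΩ'𝔊 G (Finset.mem_filter.1 hG).1, (Finset.mem_filter.1 hG).2⟩
  have h2 := hΞ Φ (fun G => (w G).2) (fun G hG => h𝔊.sub (hΦ' G hG).1)
    (fun G hG => h𝔊.nonempty G (hΦ' G hG).1)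
    (fun F hF G hG => h𝔊.eq_of_mem F (hΦ' F hF).1 G (hΦ' G hG).1)
    (fun G hG => ((hw G (hΦ' G hG).1).2.2 (hΦ' G hG).2).2)
    (fun G hG => (hw G (hΦ' G hG).1).2.1)
  -- The step values vanish on `Φ` and equal the Riemann values on the rest, so their sum is the
  -- full Riemann sum minus its part over `Φ`.
  refine Set.mem_sub.2 ⟨_, h1, _, h2, ?_⟩
  have h3 : ∑ G ∈ Φ, L (w G).2 (μ G) =
      ∑ G ∈ Ω', if (w G).2 ≠ (w G).1 then L (w G).2 (μ G) else 0 := Finset.sum_filter _ _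
  rw [h3, ← Finset.sum_sub_distrib]
  refine Finset.sum_congr rfl fun G hG => ?_
  by_cases h : (w G).2 = (w G).1
  · simp [h]
  · rw [if_pos h, sub_self, ((hw G (hΩ'𝔊 G hG)).2.2 h).1, map_zero, AddMonoidHom.zero_apply]

end GaugeToEnvelope

/-! ### Tools for gluing: finite disjoint unions, Henstock's lemma, summable errors. -/

section Gluing

variable {X V W Z : Type*} [AddCommGroup V] [AddCommGroup W] [AddCommGroup Z]
variable {L : V →+ W →+ Z} {𝔖 : Set (Set X)} {μ : Set X → W} {f : X → V}

open scoped Pointwise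

theorem mem_sigmaZeroZeroSets_iff {A : Set X} :
    A ∈ sigmaZeroZeroSets 𝔖 ↔ ∃ Ψ : Finset (Set X), IsPartition 𝔖 A ↑Ψ := by
  classical
  constructor
  · rintro ⟨𝔇, h1, h2, h3, rfl⟩
    refine ⟨(h2.subset Set.sdiff_subset : (𝔇 \ {∅}).Finite).toFinset, ?_⟩
    rw [Set.Finite.coe_toFinset]
    refine IsDecomposition.isPartition ⟨fun E hE => h1 hE.1,
      (h2.subset Set.sdiff_subset).countable, h3.subset Set.sdiff_subset, ?_⟩
      fun E hE => Set.nonempty_iff_ne_empty.2 hE.2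
    rw [Set.sUnion_sdiff_singleton_empty]
  · rintro ⟨Ψ, h⟩
    obtain ⟨h1, _, h2, h3⟩ := h.isDecomposition
    exact ⟨Ψ, h1, Finset.finite_toSet _, h2, h3⟩

theorem sigmaZeroZeroSets_subset : sigmaZeroZeroSets 𝔖 ⊆ sigmaZeroSets 𝔖 := by
  rintro A ⟨𝔇, h1, h2, _, h3⟩
  exact ⟨𝔇, h1, h2, h3⟩

theorem sigmaZeroSets_subset : sigmaZeroSets 𝔖 ⊆ sigmaSets 𝔖 := by
  rintro A ⟨𝔇, h1, h2, h3⟩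
  exact ⟨𝔇, h1, h2.countable, h3⟩

theorem empty_mem_sigmaZeroZeroSets : (∅ : Set X) ∈ sigmaZeroZeroSets 𝔖 :=
  ⟨∅, by simp, by simp, by simp, by simp⟩

theorem mem_sigmaZeroZeroSets_of_mem {A : Set X} (hA : A ∈ 𝔖) : A ∈ sigmaZeroZeroSets 𝔖 :=
  ⟨{A}, by simpa, by simp, by simp, by simp⟩

theorem union_mem_sigmaZeroZeroSets {A B : Set X} (hA : A ∈ sigmaZeroZeroSets 𝔖)
    (hB : B ∈ sigmaZeroZeroSets 𝔖) (hd : Disjoint A B) : A ∪ B ∈ sigmaZeroZeroSets 𝔖 := by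
  classical
  rw [mem_sigmaZeroZeroSets_iff] at *
  obtain ⟨Ψ, h1⟩ := hA
  obtain ⟨Φ, h2⟩ := hB
  exact ⟨Ψ ∪ Φ, by rw [Finset.coe_union]; exact h1.union h2 hd⟩

theorem union_mem_sigmaZeroSets {A B : Set X} (hA : A ∈ sigmaZeroSets 𝔖)
    (hB : B ∈ sigmaZeroSets 𝔖) : A ∪ B ∈ sigmaZeroSets 𝔖 := by
  obtain ⟨𝔇, h1, h2, rfl⟩ := hA
  obtain ⟨𝔈, h3, h4, rfl⟩ := hB
  exact ⟨𝔇 ∪ 𝔈, Set.union_subset h1 h3, h2.union h4, Set.sUnion_union _ _⟩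

theorem union_mem_sigmaSets {A B : Set X} (hA : A ∈ sigmaSets 𝔖)
    (hB : B ∈ sigmaSets 𝔖) : A ∪ B ∈ sigmaSets 𝔖 := by
  obtain ⟨𝔇, h1, h2, rfl⟩ := hA
  obtain ⟨𝔈, h3, h4, rfl⟩ := hB
  exact ⟨𝔇 ∪ 𝔈, Set.union_subset h1 h3, h2.union h4, Set.sUnion_union _ _⟩

theorem DotSubset.subset {A B : Set X} (h : DotSubset 𝔖 A B) : A ⊆ B := by
  obtain ⟨C, _, _, rfl⟩ := h
  exact Set.subset_union_left

theorem DotSubset.refl (A : Set X) : DotSubset 𝔖 A A :=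
  ⟨∅, empty_mem_sigmaZeroZeroSets, by simp, by simp⟩

theorem DotSubset.trans {A B C : Set X} (h : DotSubset 𝔖 A B) (h' : DotSubset 𝔖 B C) :
    DotSubset 𝔖 A C := by
  obtain ⟨D, h1, h2, rfl⟩ := h
  obtain ⟨E, h3, h4, rfl⟩ := h'
  rw [Set.disjoint_union_left] at h4
  exact ⟨D ∪ E, union_mem_sigmaZeroZeroSets h1 h3 h4.2, Set.disjoint_union_right.2 ⟨h2, h4.1⟩,
    (Set.union_assoc _ _ _).symm⟩

theorem dec_of_mem_sigmaZeroZeroSets {A : Set X} (hA : A ∈ sigmaZeroZeroSets 𝔖) : Dec 𝔖 A := by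
  obtain ⟨Ψ, h⟩ := mem_sigmaZeroZeroSets_iff.1 hA
  exact ⟨_, h, fun _ _ => trivial⟩

theorem dec_diff_of_mem_sigmaZeroZeroSets (h𝔖 : IsIntervalSystem 𝔖) {A B : Set X} (hA : Dec 𝔖 A)
    (hB : B ∈ sigmaZeroZeroSets 𝔖) : Dec 𝔖 (A \ B) := by
  obtain ⟨Ψ, h⟩ := mem_sigmaZeroZeroSets_iff.1 hB
  rw [← h.sUnion_eq]
  exact dec_diff_sUnion h𝔖 hA (Finset.finite_toSet _) h.sub

theorem IsGauge.exists_adm_partition (h𝔖 : IsIntervalSystem 𝔖) {A : Set X} (hA : Dec 𝔖 A)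
    {r : X → Set X} (hr : IsGauge 𝔖 A r) (f : X → V) : ∃ (𝔈 : Set (Set X)) (v : Set X → V),
      IsPartition 𝔖 A 𝔈 ∧ ∀ E ∈ 𝔈, Adm f A r E (v E) :=
  ((hr.hasPartition h𝔖 hA).mono (q := fun E => ∃ v, Adm f A r E v)
    (by rintro E _ _ _ ⟨x, hx, hE⟩; exact ⟨f x, x, hx, hE, rfl⟩)).exists_val

theorem IsPartition.disjoint_of_disjoint {A B : Set X} {𝔈 𝔉 : Set (Set X)}
    (hA : IsPartition 𝔖 A 𝔈) (hB : IsPartition 𝔖 B 𝔉) (hd : Disjoint A B) : Disjoint 𝔈 𝔉 :=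
  Set.disjoint_left.2 fun E hE hF => by
    obtain ⟨x, hx⟩ := hA.nonempty E hE
    exact Set.disjoint_left.1 hd (hA.subset hE hx) (hB.subset hF hx)

theorem EvIn.split {𝔈 ℜ : Set (Set X)} {g : Set X → Z} {T : Set Z} (h : EvIn (𝔈 ∪ ℜ) g T)
    (hd : Disjoint 𝔈 ℜ) : ∃ Ξ Ψ : Finset (Set X), ↑Ξ ⊆ 𝔈 ∧ ↑Ψ ⊆ ℜ ∧ ∀ Ω Ψ' : Finset (Set X),
      Ξ ⊆ Ω → ↑Ω ⊆ 𝔈 → Ψ ⊆ Ψ' → ↑Ψ' ⊆ ℜ → ∑ E ∈ Ω, g E + ∑ E ∈ Ψ', g E ∈ T := by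
  classical
  obtain ⟨Ξ, h1, h2⟩ := h
  refine ⟨Ξ.filter (· ∈ 𝔈), Ξ.filter (· ∈ ℜ), fun E hE => (Finset.mem_filter.1 hE).2,
    fun E hE => (Finset.mem_filter.1 hE).2, fun Ω Ψ' h3 h4 h5 h6 => ?_⟩
  rw [← Finset.sum_union (Finset.disjoint_left.2 fun E hE hE' =>
    Set.disjoint_left.1 hd (h4 hE) (h6 hE'))]
  refine h2 _ (fun E hE => ?_) (by rw [Finset.coe_union]; exact Set.union_subset_union h4 h6)
  rcases h1 hE with h | h
  · exact Finset.mem_union_left _ (h3 (Finset.mem_filter.2 ⟨hE, h⟩))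
  · exact Finset.mem_union_right _ (h5 (Finset.mem_filter.2 ⟨hE, h⟩))

theorem Controls.evIn_union {A B : Set X} {T : Set Z} {r : X → Set X}
    (h : Controls L 𝔖 μ f (A ∪ B) T r) (hd : Disjoint A B) {𝔈 ℜ : Set (Set X)}
    {v u : Set X → V} (h𝔈 : IsPartition 𝔖 A 𝔈) (hℜ : IsPartition 𝔖 B ℜ)
    (hv : ∀ E ∈ 𝔈, Adm f (A ∪ B) r E (v E)) (hu : ∀ E ∈ ℜ, Adm f (A ∪ B) r E (u E)) :
    ∃ Ξ Ψ : Finset (Set X), ↑Ξ ⊆ 𝔈 ∧ ↑Ψ ⊆ ℜ ∧ ∀ Ω Ψ' : Finset (Set X),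
      Ξ ⊆ Ω → ↑Ω ⊆ 𝔈 → Ψ ⊆ Ψ' → ↑Ψ' ⊆ ℜ →
      ∑ E ∈ Ω, L (v E) (μ E) + ∑ E ∈ Ψ', L (u E) (μ E) ∈ T := by
  classical
  have hd' := h𝔈.disjoint_of_disjoint hℜ hd
  let w : Set X → V := fun E => if E ∈ 𝔈 then v E else u E
  have hw1 : ∀ E ∈ 𝔈, w E = v E := fun E hE => if_pos hE
  have hw2 : ∀ E ∈ ℜ, w E = u E := fun E hE => if_neg fun h => Set.disjoint_left.1 hd' h hE
  obtain ⟨Ξ, Ψ, h1, h2, h3⟩ := (h.evIn _ w (h𝔈.union hℜ hd) (fun E hE => by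
    rcases hE with hE | hE
    · rw [hw1 E hE]; exact hv E hE
    · rw [hw2 E hE]; exact hu E hE)).split hd'
  refine ⟨Ξ, Ψ, h1, h2, fun Ω Ψ' h4 h5 h6 h7 => ?_⟩
  convert h3 Ω Ψ' h4 h5 h6 h7 using 2
  · exact Finset.sum_congr rfl fun E hE => by rw [hw1 E (h5 hE)]
  · exact Finset.sum_congr rfl fun E hE => by rw [hw2 E (h7 hE)]

/-- A form of Henstock's lemma. -/
theorem Controls.henstock (h𝔖 : IsIntervalSystem 𝔖) {A D : Set X} (hA : Dec 𝔖 A) {T : Set Z}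
    {r : X → Set X} (h : Controls L 𝔖 μ f A T r) (hDA : D ⊆ A) {Ω : Finset (Set X)}
    (hΩ : IsPartition 𝔖 D ↑Ω) {v w : Set X → V} (hv : ∀ E ∈ Ω, Adm f A r E (v E))
    {𝔊 : Set (Set X)} (h𝔊 : IsPartition 𝔖 D 𝔊) (hw : ∀ E ∈ 𝔊, Adm f A r E (w E)) :
    EvIn 𝔊 (fun E => L (w E) (μ E)) {z | ∑ E ∈ Ω, L (v E) (μ E) - z ∈ T - T} := by
  classical
  have hrest := dec_diff_of_mem_sigmaZeroZeroSets h𝔖 hA (mem_sigmaZeroZeroSets_iff.2 ⟨Ω, hΩ⟩)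
  obtain ⟨ℜ, u, hℜ, hu⟩ := (h.isGauge.mono Set.sdiff_subset).exists_adm_partition h𝔖 hrest f
  have hDA' : D ∪ A \ D = A := Set.union_sdiff_cancel hDA
  have hu' : ∀ E ∈ ℜ, Adm f A r E (u E) := fun E hE =>
    (hu E hE).mono Set.sdiff_subset (fun _ _ => subset_rfl) subset_rfl
  rw [← hDA'] at h hv hw hu'
  obtain ⟨Ξ₁, Ψ₁, h1, h2, h3⟩ := h.evIn_union Set.disjoint_sdiff_right hΩ hℜ hv hu'
  obtain ⟨Ξ₂, Ψ₂, h4, h5, h6⟩ := h.evIn_union Set.disjoint_sdiff_right h𝔊 hℜ hw hu'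
  refine ⟨Ξ₂, h4, fun Θ h7 h8 => ?_⟩
  have hΨ : ((Ψ₁ ∪ Ψ₂ : Finset (Set X)) : Set (Set X)) ⊆ ℜ := by
    rw [Finset.coe_union]; exact Set.union_subset h2 h5
  -- Both divisions of `D` are completed by the same finite part of the same division of `A \ D`,
  -- which cancels in the difference of the totals.
  refine Set.mem_sub.2 ⟨_, h3 Ω (Ψ₁ ∪ Ψ₂) h1 subset_rfl Finset.subset_union_left hΨ,
    _, h6 Θ (Ψ₁ ∪ Ψ₂) h7 h8 Finset.subset_union_right hΨ, ?_⟩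
  abel

theorem sum_eq_sum_filter_subset [DecidableEq (Set X)] {𝔉 : Set (Set X)} {B : Set X}
    (h𝔉 : IsPartition 𝔖 B 𝔉) {Λ J : Finset (Set X)} (hJ : ↑J ⊆ 𝔉) (hne : ∀ G ∈ Λ, G.Nonempty)
    (hΛ : ∀ G ∈ Λ, ∃ F ∈ J, G ⊆ F) (g : Set X → Z) [∀ F : Set X, DecidablePred (· ⊆ F)] :
    ∑ G ∈ Λ, g G = ∑ F ∈ J, ∑ G ∈ Λ with G ⊆ F, g G := by
  rw [← Finset.sum_biUnion]
  · refine Finset.sum_congr ?_ fun _ _ => rfl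
    ext G
    simp only [Finset.mem_biUnion, Finset.mem_filter]
    exact ⟨fun hG => (hΛ G hG).imp fun F hF => ⟨hF.1, hG, hF.2⟩, fun ⟨F, _, hG, _⟩ => hG⟩
  · intro F hF F' hF' hne'
    refine Finset.disjoint_left.2 fun G hG hG' => hne' ?_
    obtain ⟨x, hx⟩ := hne G (Finset.mem_filter.1 hG).1
    exact h𝔉.eq_of_mem F (hJ hF) F' (hJ hF') x ((Finset.mem_filter.1 hG).2 hx)
      ((Finset.mem_filter.1 hG').2 hx)

/-- With `R 0 = U` and `R (n + 1) + R (n + 1) ⊆ R n`, finite sums of elements of `R (n + 1)` over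
distinct `n ≥ k` stay in `R k`. A countable index set is injected into `ℕ`. -/
theorem exists_nhds_sum_mem [TopologicalSpace Z] [IsTopologicalAddGroup Z] {α : Type*}
    {s : Set α} (hs : s.Countable) {U : Set Z} (hU : U ∈ 𝓝 (0 : Z)) :
    ∃ u : α → Set Z, (∀ i, u i ∈ 𝓝 (0 : Z)) ∧ ∀ (J : Finset α) (z : α → Z), ↑J ⊆ s →
      (∀ i ∈ J, z i ∈ u i) → ∑ i ∈ J, z i ∈ U := by
  classical
  have hhalf : ∀ U ∈ 𝓝 (0 : Z), ∃ V ∈ 𝓝 (0 : Z), ∀ v ∈ V, ∀ w ∈ V, v + w ∈ U :=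
    fun U hU => exists_nhds_zero_half hU
  choose! half hh1 hh2 using hhalf
  obtain ⟨R, hR0, hRs⟩ : ∃ R : ℕ → Set Z, R 0 = U ∧ ∀ n, R (n + 1) = half (R n) :=
    ⟨fun n => Nat.rec U (fun _ => half) n, rfl, fun _ => rfl⟩
  have hR : ∀ n, R n ∈ 𝓝 (0 : Z) := by
    intro n
    induction n with
    | zero => rwa [hR0]
    | succ n ih => rw [hRs]; exact hh1 _ ih
  have hadd : ∀ n, ∀ v ∈ R (n + 1), ∀ w ∈ R (n + 1), v + w ∈ R n := by
    intro n v hv w hw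
    rw [hRs] at hv hw
    exact hh2 _ (hR n) v hv w hw
  have key : ∀ (m k : ℕ) (J : Finset ℕ) (z : ℕ → Z), (∀ n ∈ J, k ≤ n ∧ n < k + m) →
      (∀ n ∈ J, z n ∈ R (n + 1)) → ∑ n ∈ J, z n ∈ R k := by
    intro m
    induction m with
    | zero =>
      intro k J z h1 _
      rw [Finset.sum_eq_zero fun n hn => by have := h1 n hn; omega]
      exact mem_of_mem_nhds (hR k)
    | succ m ih =>
      intro k J z h1 h2
      have h3 : ∑ n ∈ J.erase k, z n ∈ R (k + 1) := by
        refine ih (k + 1) _ z (fun n hn => ?_) fun n hn => h2 n (Finset.mem_of_mem_erase hn)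
        have := h1 n (Finset.mem_of_mem_erase hn)
        have := Finset.ne_of_mem_erase hn
        omega
      by_cases hk : k ∈ J
      · rw [← Finset.add_sum_erase J z hk]
        exact hadd k _ (h2 k hk) _ h3
      · rw [← Finset.erase_eq_of_notMem hk, ← zero_add (∑ n ∈ _, _)]
        exact hadd k _ (mem_of_mem_nhds (hR (k + 1))) _ h3
  obtain ⟨e, he⟩ := Set.countable_iff_exists_injOn.1 hs
  refine ⟨fun i => R (e i + 1), fun i => hR _, fun J z hJ hz => ?_⟩
  rw [← Finset.sum_fiberwise_of_maps_to (g := e) (t := J.image e)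
    fun i hi => Finset.mem_image_of_mem e hi, ← hR0]
  refine key ((J.image e).sup id + 1) 0 _ _ (fun n hn => ⟨Nat.zero_le _, ?_⟩) fun n hn => ?_
  · have := Finset.le_sup (f := id) hn
    simp only [id_eq] at this
    omega
  · obtain ⟨i, hi, rfl⟩ := Finset.mem_image.1 hn
    have : J.filter (fun j => e j = e i) = {i} := by
      ext j
      simp only [Finset.mem_filter, Finset.mem_singleton]
      exact ⟨fun h => he (hJ h.1) (hJ hi) h.2, by rintro rfl; exact ⟨hi, rfl⟩⟩
    rw [this, Finset.sum_singleton]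
    exact hz i hi

end Gluing

/-! ### Passage between finite and countable supporting sets. -/

section Main

variable {X V W Z : Type*} [AddCommGroup V] [AddCommGroup W] [AddCommGroup Z]
variable {L : V →+ W →+ Z} {𝔖 : Set (Set X)} {μ : Set X → W} {f : X → V} {a : Z}
variable [TopologicalSpace Z] [IsTopologicalAddGroup Z]

open scoped Pointwise

theorem exists_nhds_sub_sub_subset {T' : Set Z} (hT' : T' ∈ 𝓝 a) :
    ∃ T ∈ 𝓝 a, T - (T - T) ⊆ T' := by
  have hc : ContinuousAt (fun p : Z × Z × Z => p.1 - (p.2.1 - p.2.2)) (a, a, a) := by fun_prop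
  have h1 : T' ∈ 𝓝 (a - (a - a)) := by simpa
  have h2 := hc.preimage_mem_nhds h1
  rw [nhds_prod_eq, nhds_prod_eq, mem_prod_iff] at h2
  obtain ⟨T₁, hT₁, S, hS, h3⟩ := h2
  obtain ⟨T₂, hT₂, T₃, hT₃, h4⟩ := mem_prod_iff.1 hS
  refine ⟨T₁ ∩ (T₂ ∩ T₃), inter_mem hT₁ (inter_mem hT₂ hT₃), ?_⟩
  rintro _ ⟨x, hx, _, ⟨y, hy, z, hz, rfl⟩, rfl⟩
  exact h3 (⟨hx.1, h4 ⟨hy.2.1, hz.2.2⟩⟩ : (x, y, z) ∈ T₁ ×ˢ S)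

theorem exists_nhds_sub_subset {U : Set Z} (hU : U ∈ 𝓝 (0 : Z)) (a : Z) :
    ∃ T ∈ 𝓝 a, T - T ⊆ U := by
  have hc : ContinuousAt (fun p : Z × Z => p.1 - p.2) (a, a) := by fun_prop
  have h1 : U ∈ 𝓝 (a - a) := by simpa
  have h2 := hc.preimage_mem_nhds h1
  rw [nhds_prod_eq, mem_prod_iff] at h2
  obtain ⟨T₁, hT₁, T₂, hT₂, h3⟩ := h2
  refine ⟨T₁ ∩ T₂, inter_mem hT₁ hT₂, ?_⟩
  rintro _ ⟨x, hx, y, hy, rfl⟩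
  exact h3 (⟨hx.1, hy.2⟩ : (x, y) ∈ T₁ ×ˢ T₂)

theorem exists_nhds_add_mem {T' : Set Z} (hT' : T' ∈ 𝓝 a) :
    ∃ T ∈ 𝓝 a, ∃ U ∈ 𝓝 (0 : Z), ∀ x ∈ T, ∀ y ∈ T, ∀ z ∈ T, ∀ u ∈ U, x + (u + (y - z)) ∈ T' := by
  have hc : ContinuousAt (fun p : Z × Z => p.1 + p.2) (a, 0) := by fun_prop
  have h1 : T' ∈ 𝓝 (a + 0) := by simpa
  have h2 := hc.preimage_mem_nhds h1
  rw [nhds_prod_eq, mem_prod_iff] at h2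
  obtain ⟨T₁, hT₁, U₁, hU₁, h3⟩ := h2
  obtain ⟨U, hU, h4⟩ := exists_nhds_zero_half hU₁
  obtain ⟨T₂, hT₂, h5⟩ := exists_nhds_sub_subset hU a
  refine ⟨T₁ ∩ T₂, inter_mem hT₁ hT₂, U, hU, fun x hx y hy z hz u hu => ?_⟩
  exact h3 (⟨hx.1, h4 u hu _ (h5 ⟨y, hy.2, z, hz.2, rfl⟩)⟩ : (x, u + (y - z)) ∈ T₁ ×ˢ U₁)

/-- Convergence along finite disjoint unions extends to all countable unions. -/
theorem exists_controls_of_disjoint_finite (h𝔖 : IsIntervalSystem 𝔖)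
    (h : ∀ T ∈ 𝓝 a, ∀ A ∈ sigmaZeroZeroSets 𝔖, ∃ A₁ ∈ sigmaZeroZeroSets 𝔖, DotSubset 𝔖 A A₁ ∧
      ∀ B ∈ sigmaZeroZeroSets 𝔖, DotSubset 𝔖 A₁ B → ∃ r, Controls L 𝔖 μ f B T r)
    {T' : Set Z} (hT' : T' ∈ 𝓝 a) {A₀ : Set X} (hA₀ : A₀ ∈ sigmaZeroZeroSets 𝔖) :
    ∃ A₁ ∈ sigmaZeroZeroSets 𝔖, DotSubset 𝔖 A₀ A₁ ∧
      ∀ B, Dec 𝔖 B → A₁ ⊆ B → ∃ r, Controls L 𝔖 μ f B T' r := by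
  classical
  obtain ⟨T, hT, U, hU, hTU⟩ := exists_nhds_add_mem hT'
  obtain ⟨A₁, hA₁, hdot, hctl⟩ := h T hT A₀ hA₀
  refine ⟨A₁, hA₁, hdot, fun B hB hA₁B => ?_⟩
  have hA₁d := dec_of_mem_sigmaZeroZeroSets hA₁
  obtain ⟨_, hr₁⟩ := hctl A₁ hA₁ (DotSubset.refl A₁)
  obtain ⟨r₁, hr₁, hr₁A⟩ := hr₁.exists_subset h𝔖 hA₁d
  obtain ⟨𝔉, h𝔉, -⟩ := dec_diff_of_mem_sigmaZeroZeroSets h𝔖 hB hA₁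
  obtain ⟨u, hu, hu'⟩ := exists_nhds_sum_mem h𝔉.countable hU
  -- `F` itself need not be controlled, but some larger `C` is; that suffices for
  -- `Controls.henstock` on subsets of `F`.
  have hF : ∀ F ∈ 𝔉, ∃ (C : Set X) (S : Set Z) (q s : X → Set X), F ⊆ C ∧ Dec 𝔖 C ∧
      S - S ⊆ u F ∧ Controls L 𝔖 μ f C S q ∧ IsGauge 𝔖 F s ∧ ∀ x ∈ F, s x ⊆ q x ∩ F := by
    intro F hF
    obtain ⟨S, hS, hSu⟩ := exists_nhds_sub_subset (hu F) a
    obtain ⟨C, hC, hFC, hCc⟩ := h S hS F (mem_sigmaZeroZeroSets_of_mem (h𝔉.sub hF))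
    obtain ⟨q, hq⟩ := hCc C hC (DotSubset.refl C)
    obtain ⟨s, hs, hsq⟩ := (hq.isGauge.mono hFC.subset).inf h𝔖 (isGauge_const (h𝔉.sub hF))
    exact ⟨C, S, q, s, hFC.subset, dec_of_mem_sigmaZeroZeroSets hC, hSu, hq, hs, hsq⟩
  choose! C S q s hFC hC hSu hq hs hsq using hF
  have hFA : ∀ F ∈ 𝔉, Disjoint F A₁ := fun F hF =>
    Set.disjoint_sdiff_left.mono_left (h𝔉.subset hF)
  have hpar : ∀ x ∈ B \ A₁, ∃ F ∈ 𝔉, x ∈ F := fun x hx => (h𝔉.mem_iff x).1 hx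
  choose! par hpar1 hpar2 using hpar
  -- The glued gauge keeps each admissible set inside `A₁` or inside a single cell of `𝔉`, so
  -- divisions split accordingly.
  let r : X → Set X := fun x => if x ∈ A₁ then r₁ x else s (par x) x
  have hrA : ∀ x ∈ A₁, r x = r₁ x := fun x hx => if_pos hx
  have hrF : ∀ x ∈ B \ A₁, r x = s (par x) x := fun x hx => if_neg hx.2
  have hr : IsGauge 𝔖 B r := by
    refine ⟨fun x hx => ?_, fun x hx => ?_, Set.Countable.mono
      (s₂ := r₁ '' A₁ ∪ ⋃ F ∈ 𝔉, s F '' F) ?_ (hr₁.isGauge.countable.union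
        (h𝔉.countable.biUnion fun F hF => (hs F hF).countable))⟩
    · by_cases hxA : x ∈ A₁
      · rw [hrA x hxA]; exact hr₁.isGauge.mem x hxA
      · rw [hrF x ⟨hx, hxA⟩]
        exact (hs _ (hpar1 x ⟨hx, hxA⟩)).mem x (hpar2 x ⟨hx, hxA⟩)
    · by_cases hxA : x ∈ A₁
      · rw [hrA x hxA]; exact hr₁.isGauge.self_mem x hxA
      · rw [hrF x ⟨hx, hxA⟩]
        exact (hs _ (hpar1 x ⟨hx, hxA⟩)).self_mem x (hpar2 x ⟨hx, hxA⟩)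
    · rintro _ ⟨x, hx, rfl⟩
      by_cases hxA : x ∈ A₁
      · exact Or.inl ⟨x, hxA, (hrA x hxA).symm⟩
      · refine Or.inr (Set.mem_biUnion (hpar1 x ⟨hx, hxA⟩) ?_)
        exact ⟨x, hpar2 x ⟨hx, hxA⟩, (hrF x ⟨hx, hxA⟩).symm⟩
  have hadm : ∀ E v, Adm f B r E v → (Adm f A₁ r₁ E v ∧ E ⊆ A₁) ∨
      ∃ F ∈ 𝔉, Adm f (C F) (q F) E v ∧ E ⊆ F := by
    rintro E v ⟨x, hx, h1, h2⟩
    by_cases hxA : x ∈ A₁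
    · rw [hrA x hxA] at h1
      exact Or.inl ⟨⟨x, hxA, h1, h2⟩, h1.trans ((hr₁A x hxA).trans Set.inter_subset_right)⟩
    · have hx' : x ∈ B \ A₁ := ⟨hx, hxA⟩
      rw [hrF x hx'] at h1
      have h3 := h1.trans (hsq _ (hpar1 x hx') x (hpar2 x hx'))
      exact Or.inr ⟨par x, hpar1 x hx', ⟨x, hFC _ (hpar1 x hx') (hpar2 x hx'),
        h3.trans Set.inter_subset_left, h2⟩, h3.trans Set.inter_subset_right⟩
  have hadmA : ∀ E v, Adm f B r E v → ∀ x ∈ E, x ∈ A₁ → Adm f A₁ r₁ E v ∧ E ⊆ A₁ := by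
    intro E v hE x hx hxA
    rcases hadm E v hE with h1 | ⟨F, hF, _, h1⟩
    · exact h1
    · exact (Set.disjoint_left.1 (hFA F hF) (h1 hx) hxA).elim
  have hadmF : ∀ E v, Adm f B r E v → ∀ x ∈ E, ∀ F ∈ 𝔉, x ∈ F →
      Adm f (C F) (q F) E v ∧ E ⊆ F := by
    intro E v hE x hx F hF hxF
    rcases hadm E v hE with h1 | ⟨F', hF', h1, h2⟩
    · exact (Set.disjoint_left.1 (hFA F hF) hxF (h1.2 hx)).elim
    · obtain rfl := h𝔉.eq_of_mem F hF F' hF' x hxF (h2 hx)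
      exact ⟨h1, h2⟩
  have hsepA : ∀ {A : Set X} {𝔈 : Set (Set X)} {v : Set X → V}, A₁ ⊆ A → IsPartition 𝔖 A 𝔈 →
      (∀ E ∈ 𝔈, Adm f B r E (v E)) →
      EvIn {E ∈ 𝔈 | E ⊆ A₁} (fun E => L (v E) (μ E)) T := by
    intro A 𝔈 v hA h𝔈 hv
    refine hr₁.evIn _ _ (h𝔈.sep _ fun x => ⟨fun hx => ?_, fun ⟨E, _, h1, h2⟩ => h1 h2⟩)
      fun E hE => ?_
    · obtain ⟨E, hE, hxE⟩ := (h𝔈.mem_iff x).1 (hA hx)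
      exact ⟨E, hE, (hadmA E _ (hv E hE) x hxE hx).2, hxE⟩
    · obtain ⟨x, hx⟩ := h𝔈.nonempty E hE.1
      exact (hadmA E _ (hv E hE.1) x hx (hE.2 hx)).1
  refine ⟨r, hr, fun 𝔈 v h𝔈 hv => ?_⟩
  obtain ⟨Ξ₀, hΞ₀, hev₀⟩ := hsepA hA₁B h𝔈 hv
  -- The threshold concerns only the part inside `A₁`. The contribution of any finite family outside
  -- `A₁` will be shown to be small.
  refine ⟨Ξ₀, hΞ₀.trans fun E hE => hE.1, fun Ω hΩ hΩ𝔈 => ?_⟩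
  rw [← Finset.sum_filter_add_sum_filter_not Ω (· ⊆ A₁)]
  have hS₀ := hev₀ (Ω.filter (· ⊆ A₁)) (fun E hE => Finset.mem_filter.2 ⟨hΩ hE, (hΞ₀ hE).2⟩)
    fun E hE => ⟨hΩ𝔈 (Finset.mem_filter.1 hE).1, (Finset.mem_filter.1 hE).2⟩
  set Ω₁ := Ω.filter fun E => ¬ E ⊆ A₁ with hΩ₁_def
  have hΩ₁ : ∀ E ∈ Ω₁, E ∈ 𝔈 ∧ ∃ F ∈ 𝔉, Adm f (C F) (q F) E (v E) ∧ E ⊆ F := by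
    intro E hE
    have hE' := Finset.mem_filter.1 hE
    exact ⟨hΩ𝔈 hE'.1, (hadm E _ (hv E (hΩ𝔈 hE'.1))).resolve_left fun h => hE'.2 h.2⟩
  set D := ⋃₀ (Ω₁ : Set (Set X)) with hD
  have hΩ₁p : IsPartition 𝔖 D ↑Ω₁ := ⟨fun E hE => h𝔈.sub (hΩ₁ E hE).1, Finset.countable_toSet _,
    fun E hE => h𝔈.nonempty E (hΩ₁ E hE).1,
    fun E hE F hF => h𝔈.eq_of_mem E (hΩ₁ E hE).1 F (hΩ₁ F hF).1, fun x => Iff.rfl⟩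
  have hD00 : D ∈ sigmaZeroZeroSets 𝔖 := mem_sigmaZeroZeroSets_iff.2 ⟨Ω₁, hΩ₁p⟩
  have hDB : D ⊆ B := Set.sUnion_subset fun E hE => h𝔈.subset (hΩ₁ E hE).1
  have hA₁D : Disjoint A₁ D := by
    refine Set.disjoint_sUnion_right.2 fun E hE => ?_
    obtain ⟨_, F, hF, _, hEF⟩ := hΩ₁ E hE
    exact ((hFA F hF).mono_left hEF).symm
  have hA00 := union_mem_sigmaZeroZeroSets hA₁ hD00 hA₁D
  -- The gauge `k` depends on `Ω`, but it serves only for comparison. For a division `𝔊` subordinate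
  -- to both `k` and `r`, the sums over `A₁ ∪ D` and over `A₁` are both in `T`, so the part over `D`
  -- is in `T - T`.
  obtain ⟨k, hk⟩ := hctl (A₁ ∪ D) hA00 ⟨D, hD00, hA₁D, rfl⟩
  have hAB : A₁ ∪ D ⊆ B := Set.union_subset hA₁B hDB
  obtain ⟨g, hg, hgr⟩ := (hr.mono hAB).inf h𝔖 hk.isGauge
  obtain ⟨𝔊, w, h𝔊, hw⟩ := hg.exists_adm_partition h𝔖 (dec_of_mem_sigmaZeroZeroSets hA00) f
  have hwr : ∀ G ∈ 𝔊, Adm f B r G (w G) := fun G hG =>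
    (hw G hG).mono hAB (fun x hx => (hgr x hx).trans Set.inter_subset_left) subset_rfl
  obtain ⟨Θ', hΘ', hev'⟩ := hk.evIn 𝔊 w h𝔊 fun G hG =>
    (hw G hG).mono subset_rfl (fun x hx => (hgr x hx).trans Set.inter_subset_right) subset_rfl
  obtain ⟨Θ₀, hΘ₀, hev₁⟩ := hsepA Set.subset_union_left h𝔊 hwr
  have hevF : ∀ F ∈ 𝔉, EvIn {G ∈ 𝔊 | G ⊆ F} (fun G => L (w G) (μ G))
      {z | ∑ E ∈ Ω₁ with E ⊆ F, L (v E) (μ E) - z ∈ S F - S F} := by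
    intro F hF
    refine (hq F hF).henstock h𝔖 (hC F hF) (D := D ∩ F) (Set.inter_subset_right.trans (hFC F hF))
      ?_ (fun E hE => ?_) ?_ fun G hG => ?_
    · rw [Finset.coe_filter]
      refine hΩ₁p.sep _ fun x => ⟨fun hx => ?_, fun ⟨E, hE, h1, h2⟩ => ⟨⟨E, hE, h2⟩, h1 h2⟩⟩
      obtain ⟨E, hE, hxE⟩ := hx.1
      exact ⟨E, hE, (hadmF E _ (hv E (hΩ₁ E hE).1) x hxE F hF hx.2).2, hxE⟩
    · obtain ⟨hE, hEF⟩ := Finset.mem_filter.1 hE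
      obtain ⟨x, hx⟩ := h𝔈.nonempty E (hΩ₁ E hE).1
      exact (hadmF E _ (hv E (hΩ₁ E hE).1) x hx F hF (hEF hx)).1
    · refine h𝔊.sep _ fun x => ⟨fun hx => ?_, fun ⟨G, hG, h1, h2⟩ => ⟨?_, h1 h2⟩⟩
      · obtain ⟨G, hG, hxG⟩ := (h𝔊.mem_iff x).1 (Or.inr hx.1)
        exact ⟨G, hG, (hadmF G _ (hwr G hG) x hxG F hF hx.2).2, hxG⟩
      · exact (h𝔊.subset hG h2).resolve_left (Set.disjoint_left.1 (hFA F hF) (h1 h2))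
    · obtain ⟨x, hx⟩ := h𝔊.nonempty G hG.1
      exact (hadmF G _ (hwr G hG.1) x hx F hF (hG.2 hx)).1
  choose! Θ hΘ hevF using hevF
  have hpE : ∀ E ∈ Ω₁, ∃ F ∈ 𝔉, E ⊆ F := fun E hE =>
    let ⟨F, hF, _, hEF⟩ := (hΩ₁ E hE).2
    ⟨F, hF, hEF⟩
  choose! pE hpE1 hpE2 using hpE
  -- Only the finitely many cells of `𝔉` that contain members of `Ω₁` matter, so the local
  -- thresholds `Θ F` can be united into one finite family.
  set J := Ω₁.image pE with hJ_def
  have hJ : ↑J ⊆ 𝔉 := by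
    intro F hF
    obtain ⟨E, hE, rfl⟩ := Finset.mem_image.1 (Finset.mem_coe.1 hF)
    exact hpE1 E hE
  set Λ := Θ' ∪ Θ₀ ∪ J.biUnion Θ with hΛ_def
  have hΛ𝔊 : ∀ G ∈ Λ, G ∈ 𝔊 := by
    intro G hG
    rcases Finset.mem_union.1 hG with hG | hG
    · rcases Finset.mem_union.1 hG with hG | hG
      · exact hΘ' hG
      · exact (hΘ₀ hG).1
    · obtain ⟨F, hF, hG⟩ := Finset.mem_biUnion.1 hG
      exact (hΘ F (hJ hF) hG).1
  have hΛT := hev' Λ (Finset.subset_union_left.trans Finset.subset_union_left) hΛ𝔊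
  have hΛ₀T := hev₁ (Λ.filter (· ⊆ A₁)) (fun G hG => Finset.mem_filter.2
    ⟨Finset.mem_union_left _ (Finset.mem_union_right _ hG), (hΘ₀ hG).2⟩)
    fun G hG => ⟨hΛ𝔊 G (Finset.mem_filter.1 hG).1, (Finset.mem_filter.1 hG).2⟩
  rw [← Finset.sum_filter_add_sum_filter_not Λ (· ⊆ A₁)] at hΛT
  set Λ₁ := Λ.filter fun G => ¬ G ⊆ A₁ with hΛ₁_def
  have hΛ₁𝔊 : ∀ G ∈ Λ₁, G ∈ 𝔊 ∧ ¬ G ⊆ A₁ := fun G hG =>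
    ⟨hΛ𝔊 G (Finset.mem_filter.1 hG).1, (Finset.mem_filter.1 hG).2⟩
  have hsumΩ := sum_eq_sum_filter_subset h𝔉 (Λ := Ω₁) hJ
    (fun E hE => h𝔈.nonempty E (hΩ₁ E hE).1)
    (fun E hE => ⟨pE E, Finset.mem_image_of_mem _ hE, hpE2 E hE⟩) fun E => L (v E) (μ E)
  have hsumΛ := sum_eq_sum_filter_subset h𝔉 (Λ := Λ₁) hJ
    (fun G hG => h𝔊.nonempty G (hΛ₁𝔊 G hG).1)
    (fun G hG => by
      obtain ⟨x, hx⟩ := h𝔊.nonempty G (hΛ₁𝔊 G hG).1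
      have hxD : x ∈ D := (h𝔊.subset (hΛ₁𝔊 G hG).1 hx).resolve_left fun hxA =>
        (hΛ₁𝔊 G hG).2 (hadmA G _ (hwr G (hΛ₁𝔊 G hG).1) x hx hxA).2
      obtain ⟨E, hE, hxE⟩ := hxD
      exact ⟨pE E, Finset.mem_image_of_mem _ hE,
        (hadmF G _ (hwr G (hΛ₁𝔊 G hG).1) x hx _ (hpE1 E hE) (hpE2 E hE hxE)).2⟩)
    fun G => L (w G) (μ G)
  -- In each cell `F` the sums from `Ω₁` and from `𝔊` differ by an element of `u F`, so in total
  -- they differ by an element of `U`.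
  have hsmall := hu' J (fun F => ∑ E ∈ Ω₁ with E ⊆ F, L (v E) (μ E) -
      ∑ G ∈ Λ₁ with G ⊆ F, L (w G) (μ G)) hJ fun F hF => by
    refine hSu F (hJ hF) (hevF F (hJ hF) _ (fun G hG => ?_) fun G hG => ?_)
    · have hG' := hΘ F (hJ hF) hG
      refine Finset.mem_filter.2 ⟨Finset.mem_filter.2 ⟨Finset.mem_union_right _
        (Finset.mem_biUnion.2 ⟨F, hF, hG⟩), fun hGA => ?_⟩, hG'.2⟩
      obtain ⟨x, hx⟩ := h𝔊.nonempty G hG'.1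
      exact Set.disjoint_left.1 (hFA F (hJ hF)) (hG'.2 hx) (hGA hx)
    · obtain ⟨h1, h2⟩ := Finset.mem_filter.1 hG
      exact ⟨(hΛ₁𝔊 G h1).1, h2⟩
  rw [Finset.sum_sub_distrib, ← hsumΩ, ← hsumΛ] at hsmall
  convert hTU _ hS₀ _ hΛT _ hΛ₀T _ hsmall using 2
  abel

/-- It is enough to control unions with one countable union. -/
theorem exists_controls_disjoint_finite_of_union (h𝔖 : IsIntervalSystem 𝔖)
    (h : ∀ T ∈ 𝓝 a, ∀ A ∈ sigmaZeroZeroSets 𝔖, ∃ A₁, Dec 𝔖 A₁ ∧ A ⊆ A₁ ∧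
      ∀ B ∈ sigmaZeroZeroSets 𝔖, ∃ r, Controls L 𝔖 μ f (B ∪ A₁) T r)
    {T' : Set Z} (hT' : T' ∈ 𝓝 a) {A₀ : Set X} (hA₀ : A₀ ∈ sigmaZeroZeroSets 𝔖) :
    ∃ A₁ ∈ sigmaZeroZeroSets 𝔖, DotSubset 𝔖 A₀ A₁ ∧
      ∀ B ∈ sigmaZeroZeroSets 𝔖, A₁ ⊆ B → ∃ r, Controls L 𝔖 μ f B T' r := by
  classical
  obtain ⟨T, hT, hTT⟩ := exists_nhds_sub_sub_subset hT'
  obtain ⟨A₁, hA₁, hA₀₁, hctl⟩ := h T hT A₀ hA₀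
  obtain ⟨r, hr⟩ := hctl ∅ empty_mem_sigmaZeroZeroSets
  rw [Set.empty_union] at hr
  obtain ⟨Ψ, hΨ⟩ := mem_sigmaZeroZeroSets_iff.1 hA₀
  obtain ⟨ℜ, hℜ, -⟩ := dec_diff_of_mem_sigmaZeroZeroSets h𝔖 hA₁ hA₀
  have h𝔈 := hΨ.union hℜ Set.disjoint_sdiff_right
  rw [Set.union_sdiff_cancel hA₀₁] at h𝔈
  -- The finite union sought is `A₀` together with the exceptional cells `Ξ`. If `B` contains it,
  -- sets disjoint from `B` and inside cells of `𝔈` avoid `Ξ`, and their Riemann sums are small.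
  obtain ⟨Ξ, hΞ𝔈, hΞ⟩ := hr.exists_finset_tail h𝔖 h𝔈
  set Φ := Ξ.filter (· ∈ ℜ) with hΦ
  have hΦℜ : ∀ E ∈ Φ, E ∈ ℜ := fun E hE => (Finset.mem_filter.1 hE).2
  have hΦp : IsPartition 𝔖 (⋃₀ (Φ : Set (Set X))) ↑Φ := ⟨fun E hE => hℜ.sub (hΦℜ E hE),
    Finset.countable_toSet _, fun E hE => hℜ.nonempty E (hΦℜ E hE),
    fun E hE F hF => hℜ.eq_of_mem E (hΦℜ E hE) F (hΦℜ F hF), fun x => Iff.rfl⟩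
  have hΦ00 : ⋃₀ (Φ : Set (Set X)) ∈ sigmaZeroZeroSets 𝔖 :=
    mem_sigmaZeroZeroSets_iff.2 ⟨Φ, hΦp⟩
  have hdisj : Disjoint A₀ (⋃₀ (Φ : Set (Set X))) := Set.disjoint_sUnion_right.2 fun E hE =>
    Set.disjoint_sdiff_right.mono_right (hℜ.subset (hΦℜ E hE))
  refine ⟨_, union_mem_sigmaZeroZeroSets hA₀ hΦ00 hdisj, ⟨_, hΦ00, hdisj, rfl⟩,
    fun B hB hsub => ?_⟩
  have hΞB : ∀ E ∈ Ξ, E ⊆ B := by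
    intro E hE
    refine Set.Subset.trans ?_ hsub
    rcases hΞ𝔈 hE with h1 | h1
    · exact (hΨ.subset h1).trans Set.subset_union_left
    · exact (Set.subset_sUnion_of_mem (Finset.mem_coe.2 (Finset.mem_filter.2 ⟨hE, h1⟩))).trans
        Set.subset_union_right
  obtain ⟨k, hk⟩ := hctl B hB
  have hBA : B ∪ A₁ = B ∪ A₁ \ B := by rw [Set.union_sdiff_self]
  rw [hBA] at hk
  refine ⟨k, hk.isGauge.mono Set.subset_union_left, fun 𝔓 v h𝔓 hv => ?_⟩
  have hdec := dec_diff_of_mem_sigmaZeroZeroSets h𝔖 hA₁ hB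
  obtain ⟨s, hs, hsk⟩ := (hk.isGauge.mono Set.subset_union_right).inf h𝔖
    (hr.isGauge.mono Set.sdiff_subset)
  -- A division of `B` is completed to one of `B ∪ A₁` by cells subordinate both to `k`, so that the
  -- total is in `T`, and to `r`, so that the added part is in `T - T`.
  have h𝔑 : HasPartition 𝔖 (fun G => ∃ w, Adm f (A₁ \ B) s G w ∧ ∃ E ∈ ↑Ψ ∪ ℜ, G ⊆ E)
      (A₁ \ B) := by
    have h1 : HasPartition 𝔖 (fun G => ∃ E ∈ ↑Ψ ∪ ℜ, G ⊆ E) (A₁ \ B) :=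
      Dec.subordinate h𝔖 hdec h𝔈.countable h𝔈.sub
        (by rw [h𝔈.sUnion_eq]; exact Set.sdiff_subset)
    refine h1.bind fun F hF hFA _ ⟨E, hE, hFE⟩ => ?_
    refine ((hs.mono hFA).hasPartition h𝔖 (hasPartition_self hF trivial)).mono ?_
    rintro G - hGF - ⟨x, hx, hG⟩
    exact ⟨f x, ⟨x, hFA hx, hG, rfl⟩, E, hE, hGF.trans hFE⟩
  obtain ⟨𝔑, w, h𝔑, hw⟩ := h𝔑.exists_val
  obtain ⟨Ξ₁, Ψ₁, h1, h2, h3⟩ := hk.evIn_union Set.disjoint_sdiff_right h𝔓 h𝔑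
    (fun E hE => (hv E hE).mono Set.subset_union_left (fun _ _ => subset_rfl) subset_rfl)
    (fun G hG => (hw G hG).1.mono Set.subset_union_right
      (fun x hx => (hsk x hx).trans Set.inter_subset_left) subset_rfl)
  refine ⟨Ξ₁, h1, fun Ω h4 h5 => hTT ?_⟩
  have h6 := hΞ Ψ₁ w (h2.trans h𝔑.sub) (fun G hG => h𝔑.nonempty G (h2 hG))
    (fun F hF G hG => h𝔑.eq_of_mem F (h2 hF) G (h2 hG))
    (fun G hG => by
      obtain ⟨E, hE, hGE⟩ := (hw G (h2 hG)).2
      refine ⟨E, hE, fun hEΞ => ?_, hGE⟩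
      obtain ⟨x, hx⟩ := h𝔑.nonempty G (h2 hG)
      exact (h𝔑.subset (h2 hG) hx).2 (hΞB E hEΞ (hGE hx)))
    (fun G hG => (hw G (h2 hG)).1.mono Set.sdiff_subset
      (fun x hx => (hsk x hx).trans Set.inter_subset_right) subset_rfl)
  refine Set.mem_sub.2 ⟨_, h3 Ω Ψ₁ h4 h5 subset_rfl h2, _, h6, ?_⟩
  abel

end Main

/-! ### The equivalences. -/

section Equivalences

variable {X V W Z : Type*} [AddCommGroup V] [AddCommGroup W] [AddCommGroup Z]
variable {L : V →+ W →+ Z} {𝔖 : Set (Set X)} {μ : Set X → W} {f : X → V} {a : Z}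

theorem tendsto_limitFilter_lmFilter_iff [TopologicalSpace Z] (h𝔖 : IsIntervalSystem 𝔖)
    {ℱ : Set (Set X)} (hℱ : ∀ A ∈ ℱ, Dec 𝔖 A) {ρ : Set X → Set X → Prop} (hr : ∀ A, ρ A A)
    (ht : ∀ A B C, ρ A B → ρ B C → ρ A C) :
    Tendsto (evalFormal L μ f) (limitFilter (fun A B : ℱ => ρ A B) fun A => lmFilter 𝔖 (A : Set X))
      (𝓝 a) ↔ ∀ T ∈ 𝓝 a, ∀ A ∈ ℱ, ∃ A₁ ∈ ℱ, ρ A A₁ ∧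
        ∀ B ∈ ℱ, ρ A₁ B → ∃ r, Controls L 𝔖 μ f B T r := by
  rw [tendsto_limitFilter_iff (r := fun A B : ℱ => ρ A B) (fun A => hr _) fun A B C => ht _ _ _]
  refine forall₂_congr fun T _ => ?_
  simp only [Subtype.forall, Subtype.exists, exists_prop]
  refine forall₂_congr fun A _ => exists_congr fun A₁ => and_congr_right fun _ =>
    and_congr_right fun _ => forall₂_congr fun B hB => imp_congr_right fun _ => ?_
  exact preimage_mem_lmFilter_iff h𝔖 (hℱ B hB)

theorem tendsto_lmFilter_iff [TopologicalSpace Z] (h𝔖 : IsIntervalSystem 𝔖) {A : Set X}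
    (hA : Dec 𝔖 A) : Tendsto (evalFormal L μ f) (lmFilter 𝔖 A) (𝓝 a) ↔
      ∀ T ∈ 𝓝 a, ∃ r, Controls L 𝔖 μ f A T r :=
  forall₂_congr fun _ _ => preimage_mem_lmFilter_iff h𝔖 hA

variable [TopologicalSpace W] [UniformSpace Z] [IsUniformAddGroup Z] [T2Space Z]
variable (h𝔖 : IsIntervalSystem 𝔖) (hμ : IsMeasureOn 𝔖 μ) (hL : ∀ v : V, Continuous (L v))
include h𝔖 hμ hL

/-- The neighborhood `T` is chosen before `B`: the extended integral needs one `T` that serves for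
all large `B`. -/
theorem exists_nhds_envelope_of_controls {T' : Set Z} (hT' : T' ∈ 𝓝 (0 : Z)) :
    ∃ T ∈ 𝓝 a, ∀ B, Dec 𝔖 B → (∃ r, Controls L 𝔖 μ f B T r) →
      ∃ ℬ : Set (V × X), IsEnvelope 𝔖 ℬ ∧ graph (B.indicator f) ⊆ ℬ ∧
        preIntegral L 𝔖 μ ℬ ⊆ (fun t => a + t) '' T' := by
  have h1 : (fun t => a + t) '' T' ∈ 𝓝 a := by
    have := (Homeomorph.addLeft a).isOpenMap.image_mem_nhds hT'
    simpa using this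
  -- A closed neighborhood absorbs the closure left by `Controls.exists_envelope`.
  obtain ⟨S, hS, hSc, hST⟩ := exists_mem_nhds_isClosed_subset h1
  obtain ⟨T, hT, hTS⟩ := exists_nhds_sub_sub_subset hS
  refine ⟨T, hT, fun B hB ⟨r, hr⟩ => ?_⟩
  obtain ⟨ℬ, h2, h3, h4⟩ := hr.exists_envelope h𝔖 hμ hL hB
  exact ⟨ℬ, h2, h3, h4.trans ((closure_minimal hTS hSc).trans hST)⟩

variable [CompleteSpace Z]

theorem exists_nhds_controls_of_envelope {T' : Set Z} (hT' : T' ∈ 𝓝 a) :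
    ∃ T ∈ 𝓝 (0 : Z), ∀ B, Dec 𝔖 B → (∃ ℬ : Set (V × X), IsEnvelope 𝔖 ℬ ∧
      graph (B.indicator f) ⊆ ℬ ∧ preIntegral L 𝔖 μ ℬ ⊆ (fun t => a + t) '' T) →
      ∃ r, Controls L 𝔖 μ f B T' r := by
  have hc : ContinuousAt (fun p : Z × Z => a + p.1 - p.2) (0, 0) := by fun_prop
  have h1 : T' ∈ 𝓝 (a + 0 - 0) := by simpa
  have h2 := hc.preimage_mem_nhds h1
  rw [nhds_prod_eq, mem_prod_iff] at h2
  obtain ⟨T, hT, U, hU, h3⟩ := h2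
  refine ⟨T, hT, fun B hB ⟨ℬ, h4, h5, h6⟩ => ?_⟩
  refine exists_controls_of_envelope h𝔖 hμ hL hB h4 h5 h6 hU ?_
  rintro _ ⟨t, ht, rfl⟩ u hu
  exact h3 (⟨ht, hu⟩ : (t, u) ∈ T ×ˢ U)

theorem isExtIntegral_iff : IsExtIntegral L 𝔖 μ f a ↔
    ∀ T ∈ 𝓝 a, ∀ A₀ ∈ sigmaZeroZeroSets 𝔖, ∃ A₁ ∈ sigmaZeroZeroSets 𝔖, DotSubset 𝔖 A₀ A₁ ∧
      ∀ B ∈ sigmaSets 𝔖, A₁ ⊆ B → ∃ r, Controls L 𝔖 μ f B T r := by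
  constructor
  · intro h T hT A₀ hA₀
    obtain ⟨S, hS, h1⟩ := exists_nhds_controls_of_envelope (f := f) h𝔖 hμ hL hT
    obtain ⟨A', hA', hd, h2⟩ := h S hS A₀ hA₀
    exact ⟨_, union_mem_sigmaZeroZeroSets hA₀ hA' hd, ⟨A', hA', hd, rfl⟩,
      fun B hB hsub => h1 B (dec_of_mem_sigmaSets h𝔖 hB) (h2 B hB hsub)⟩
  · intro h T hT A₀ hA₀
    obtain ⟨S, hS, h1⟩ := exists_nhds_envelope_of_controls (f := f) (a := a) h𝔖 hμ hL hT
    obtain ⟨_, _, ⟨A', hA', hd, rfl⟩, h2⟩ := h S hS A₀ hA₀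
    exact ⟨A', hA', hd, fun B hB hsub =>
      h1 B (dec_of_mem_sigmaSets h𝔖 hB) (h2 B hB hsub)⟩

theorem isIntegral_iff (hX : Set.univ ∈ sigmaSets 𝔖) : IsIntegral L 𝔖 μ f a ↔
    ∀ T ∈ 𝓝 a, ∃ r, Controls L 𝔖 μ f Set.univ T r := by
  have hd := dec_of_mem_sigmaSets h𝔖 hX
  constructor
  · intro h T hT
    obtain ⟨S, hS, h1⟩ := exists_nhds_controls_of_envelope (f := f) h𝔖 hμ hL hT
    exact h1 _ hd (by simpa using h S hS)
  · intro h T hT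
    obtain ⟨S, hS, h1⟩ := exists_nhds_envelope_of_controls (f := f) (a := a) h𝔖 hμ hL hT
    simpa using h1 _ hd (h S hS)

theorem tfae_isExtIntegral : List.TFAE [
    IsExtIntegral L 𝔖 μ f a,
    Tendsto (evalFormal L μ f) (lmFilterCountable 𝔖) (𝓝 a),
    Tendsto (evalFormal L μ f) (lmFilterFinite 𝔖) (𝓝 a),
    Tendsto (evalFormal L μ f) (lmFilterDisjointFinite 𝔖) (𝓝 a)] := by
  have hS : ∀ A ∈ sigmaSets 𝔖, Dec 𝔖 A := fun A hA => dec_of_mem_sigmaSets h𝔖 hA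
  rw [isExtIntegral_iff h𝔖 hμ hL, lmFilterCountable, lmFilterFinite, lmFilterDisjointFinite,
    tendsto_limitFilter_lmFilter_iff (ρ := (· ⊆ ·)) h𝔖 hS (fun _ => subset_rfl)
      fun _ _ _ => Set.Subset.trans,
    tendsto_limitFilter_lmFilter_iff (ρ := (· ⊆ ·)) h𝔖
      (fun A hA => hS A (sigmaZeroSets_subset hA)) (fun _ => subset_rfl)
      fun _ _ _ => Set.Subset.trans,
    tendsto_limitFilter_lmFilter_iff (ρ := DotSubset 𝔖) h𝔖
      (fun A hA => hS A (sigmaZeroSets_subset (sigmaZeroZeroSets_subset hA))) DotSubset.refl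
      fun _ _ _ => DotSubset.trans]
  have hdisj : (∀ T ∈ 𝓝 a, ∀ A ∈ sigmaZeroZeroSets 𝔖, ∃ A₁, Dec 𝔖 A₁ ∧ A ⊆ A₁ ∧
      ∀ B ∈ sigmaZeroZeroSets 𝔖, ∃ r, Controls L 𝔖 μ f (B ∪ A₁) T r) →
      ∀ T ∈ 𝓝 a, ∀ A ∈ sigmaZeroZeroSets 𝔖, ∃ A₁ ∈ sigmaZeroZeroSets 𝔖, DotSubset 𝔖 A A₁ ∧
        ∀ B ∈ sigmaZeroZeroSets 𝔖, DotSubset 𝔖 A₁ B → ∃ r, Controls L 𝔖 μ f B T r := by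
    intro h T hT A hA
    obtain ⟨A₁, h1, h2, h3⟩ := exists_controls_disjoint_finite_of_union h𝔖 h hT hA
    exact ⟨A₁, h1, h2, fun B hB hAB => h3 B hB hAB.subset⟩
  tfae_have 1 → 2 := by
    intro h T hT A hA
    -- The given `A` need not be a finite disjoint union, so the condition is used from `∅`, and `A`
    -- is joined to the resulting set afterwards.
    obtain ⟨A₁, h1, -, h2⟩ := h T hT ∅ empty_mem_sigmaZeroZeroSets
    exact ⟨A ∪ A₁, union_mem_sigmaSets hA (sigmaZeroSets_subset (sigmaZeroZeroSets_subset h1)),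
      Set.subset_union_left, fun B hB hAB => h2 B hB (Set.subset_union_right.trans hAB)⟩
  tfae_have 1 → 3 := by
    intro h T hT A hA
    obtain ⟨A₁, h1, -, h2⟩ := h T hT ∅ empty_mem_sigmaZeroZeroSets
    exact ⟨A ∪ A₁, union_mem_sigmaZeroSets hA (sigmaZeroZeroSets_subset h1),
      Set.subset_union_left, fun B hB hAB =>
        h2 B (sigmaZeroSets_subset hB) (Set.subset_union_right.trans hAB)⟩
  tfae_have 2 → 4 := by
    intro h
    refine hdisj fun T hT A hA => ?_
    obtain ⟨A₁, h1, h2, h3⟩ := h T hT A (sigmaZeroSets_subset (sigmaZeroZeroSets_subset hA))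
    exact ⟨A₁, hS A₁ h1, h2, fun B hB => h3 _ (union_mem_sigmaSets
      (sigmaZeroSets_subset (sigmaZeroZeroSets_subset hB)) h1) Set.subset_union_right⟩
  tfae_have 3 → 4 := by
    intro h
    refine hdisj fun T hT A hA => ?_
    obtain ⟨A₁, h1, h2, h3⟩ := h T hT A (sigmaZeroZeroSets_subset hA)
    exact ⟨A₁, hS A₁ (sigmaZeroSets_subset h1), h2, fun B hB => h3 _ (union_mem_sigmaZeroSets
      (sigmaZeroZeroSets_subset hB) h1) Set.subset_union_right⟩
  tfae_have 4 → 1 := by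
    intro h T hT A hA
    obtain ⟨A₁, h1, h2, h3⟩ := exists_controls_of_disjoint_finite h𝔖 h hT hA
    exact ⟨A₁, h1, h2, fun B hB hAB => h3 B (hS B hB) hAB⟩
  tfae_finish

theorem tfae_isIntegral (hX : Set.univ ∈ sigmaSets 𝔖) : List.TFAE [
    IsIntegral L 𝔖 μ f a,
    IsExtIntegral L 𝔖 μ f a,
    Tendsto (evalFormal L μ f) (lmFilter 𝔖 Set.univ) (𝓝 a)] := by
  have hd := dec_of_mem_sigmaSets h𝔖 hX
  tfae_have 1 ↔ 3 := by
    rw [isIntegral_iff h𝔖 hμ hL hX, tendsto_lmFilter_iff h𝔖 hd]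
  tfae_have 2 → 1 := by
    rw [isIntegral_iff h𝔖 hμ hL hX, isExtIntegral_iff h𝔖 hμ hL]
    intro h T hT
    obtain ⟨A₁, -, -, h1⟩ := h T hT ∅ empty_mem_sigmaZeroZeroSets
    exact h1 _ hX (Set.subset_univ _)
  tfae_have 1 → 2 := by
    intro h
    rw [isIntegral_iff h𝔖 hμ hL hX] at h
    -- The definition of the extended integral asks for a finite disjoint union, which `X` need not
    -- be. Along countable unions, however, `X` is the largest index, and control on `X` alone
    -- suffices.
    refine ((tfae_isExtIntegral h𝔖 hμ hL).out 0 1 rfl rfl).2 ?_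
    rw [lmFilterCountable,
      tendsto_limitFilter_lmFilter_iff (ρ := (· ⊆ ·)) h𝔖
        (fun A hA => dec_of_mem_sigmaSets h𝔖 hA) (fun _ => subset_rfl)
        fun _ _ _ => Set.Subset.trans]
    exact fun T hT A _ => ⟨Set.univ, hX, Set.subset_univ A, fun B _ hB =>
      Set.univ_subset_iff.1 hB ▸ h T hT⟩
  tfae_finish

end Equivalences

end LM

theorem mainTheorem4 {X V W Z : Type*} [AddCommGroup V]
    [AddCommGroup W] [UniformSpace W] [IsUniformAddGroup W] [CompleteSpace W] [T2Space W]
    [AddCommGroup Z] [UniformSpace Z] [IsUniformAddGroup Z] [CompleteSpace Z] [T2Space Z]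
    (𝔖 : Set (Set X)) (h𝔖 : LM.IsIntervalSystem 𝔖)
    (μ : Set X → W) (hμ : LM.IsMeasureOn 𝔖 μ)
    (L : V →+ W →+ Z) (hL : ∀ v : V, Continuous (L v))
    (f : X → V) (a : Z) :
    List.TFAE [
      LM.IsExtIntegral L 𝔖 μ f a,
      Tendsto (LM.evalFormal L μ f) (LM.lmFilterCountable 𝔖) (𝓝 a),
      Tendsto (LM.evalFormal L μ f) (LM.lmFilterFinite 𝔖) (𝓝 a),
      Tendsto (LM.evalFormal L μ f) (LM.lmFilterDisjointFinite 𝔖) (𝓝 a)] ∧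
    (Set.univ ∈ LM.sigmaSets 𝔖 →
      List.TFAE [
        LM.IsIntegral L 𝔖 μ f a,
        LM.IsExtIntegral L 𝔖 μ f a,
        Tendsto (LM.evalFormal L μ f) (LM.lmFilter 𝔖 Set.univ) (𝓝 a)]) :=
  ⟨LM.tfae_isExtIntegral h𝔖 hμ hL, fun hX => LM.tfae_isIntegral h𝔖 hμ hL hX⟩
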